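/- Let $p\ge 0$ and $q\ge 1$ be integers and let $\mathbb{R}_{p+q}$ be the real Clifford algebra generated by $e_1,\dots,e_{p+q}$ with $e_ie_j+e_je_i=-2\delta_{ij}$; put $e_0=1$. Write points of $\mathbb{R}^{p+q+1}$ as $x=x_p+x_q$ with $x_p=\sum_{i=0}^{p}x_ie_i$ and $x_q=\sum_{i=p+1}^{p+q}x_ie_i$, and let $\mathbb{S}$ be the set of all $\omega=\sum_{i=p+1}^{p+q}\omega_ie_i$ with $\sum_i\omega_i^2=1$. Let $$D_x=\sum_{i=0}^{p+q}e_i\partial_{x_i},\qquad D_{x_p}=\sum_{i=0}^{p}e_i\partial_{x_i},\qquad \overline{D}_{x_p}=\partial_{x_0}-\sum_{i=1}^{p}e_i\partial_{x_i},\qquad \Delta_x=\sum_{i=0}^{p+q}\partial_{x_i}^2 .$$ Let $D\subseteq\mathbb{R}^{p+2}$ be an open set of points $(x_p,r)$, $x_p\in\mathbb{R}^{p+1}$, $r\in\mathbb{R}$, that is invariant under $(x_p,r)\mapsto(x_p,-r)$, and let $\Omega_D=\{x_p+r\omega : (x_p,r)\in D,\ r\ge 0,\ \omega\in\mathbb{S}\}\subseteq\mathbb{R}^{p+q+1}$.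 A function $f:\Omega_D\to\mathbb{R}_{p+q}$ is called generalized partial-slice regular of type $(p,q)$ if there are $F_1,F_2\in C^1(D,\mathbb{R}_{p+q})$, with $F_1$ even and $F_2$ odd in $r$, such that $f(x_p+r\omega)=F_1(x_p,r)+\omega F_2(x_p,r)$ for all $(x_p,r)\in D$, $r\ge 0$, $\omega\in\mathbb{S}$, and $$D_{x_p}F_1-\partial_rF_2=0,\qquad \overline{D}_{x_p}F_2+\partial_rF_1=0\qquad\text{on } D.$$ Its spherical derivative is $f'_s(x)=\tfrac12\,x_q^{-1}\bigl(f(x_p+x_q)-f(x_p-x_q)\bigr)$ for $x\in\Omega_D$ with $x_q\ne 0$. **Theorem.** Let $q$ be odd and let $f$ be generalized partial-slice regular of type $(p,q)$ on $\Omega_D$. Then $f$ is of class $C^\infty$ on $\Omega_D$, $f'_s$ extends to a function of class $C^\infty$ on $\Omega_D$ (again denoted by $f'_s$), and everywhere on $\Omega_D$: (i) $D_x\,\Delta_x^{\frac{q-1}{2}}f=(1-q)\,\Delta_x^{\frac{q-1}{2}}f'_s=0$; (ii) $\Delta_x^{\frac{q+1}{2}}f=0$, that is, $f$ is polyharmonic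 of degree $\frac{q+1}{2}$. -/

import Mathlib

open scoped ContDiff
open Laplacian

noncomputable section

/-- The quadratic form `v ↦ -∑ vᵢ²` on `ℝⁿ`. -/
abbrev negSumSquares (n : ℕ) : QuadraticForm ℝ (Fin n → ℝ) :=
  QuadraticMap.weightedSumSquares ℝ (fun _ : Fin n => (-1 : ℝ))

/-- The real Clifford algebra `ℝₙ`, generated by `e₁, …, eₙ` with
`eᵢ eⱼ + eⱼ eᵢ = -2 δᵢⱼ`. -/
abbrev RealClifford (n : ℕ) : Type := CliffordAlgebra (negSumSquares n)

namespace RealClifford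

/-- A basis of `ℝₙ` indexed by the subsets `A` of `{1, …, n}`: the exterior basis
`e_{j₁} ∧ ⋯ ∧ e_{jᵣ}` transported through the linear isomorphism of `ℝₙ` with the exterior
algebra. -/
def basis (n : ℕ) : Module.Basis (Finset (Fin n)) ℝ (RealClifford n) :=
  letI : Invertible (2 : ℝ) := invertibleOfNonzero two_ne_zero
  (Pi.basisFun ℝ (Fin n)).ExteriorAlgebra.map (CliffordAlgebra.equivExterior (negSumSquares n)).symm

/-- The coordinates of an element of `ℝₙ`, in the Euclidean space `ℝ^(2^n)`. -/
def coords (n : ℕ) : RealClifford n ≃ₗ[ℝ] EuclideanSpace ℝ (Finset (Fin n)) :=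
  (basis n).equivFun.trans (WithLp.linearEquiv 2 ℝ (Finset (Fin n) → ℝ)).symm

/-- The Euclidean norm of the coordinates. (`ℝₙ` has finite dimension, so continuity and
derivatives do not depend on the choice of the norm.) -/
instance instNormedAddCommGroup (n : ℕ) : NormedAddCommGroup (RealClifford n) :=
  NormedAddCommGroup.induced (RealClifford n) (EuclideanSpace ℝ (Finset (Fin n))) (coords n)
    (coords n).injective

instance instNormedSpace (n : ℕ) : NormedSpace ℝ (RealClifford n) :=
  NormedSpace.induced ℝ (RealClifford n) (EuclideanSpace ℝ (Finset (Fin n))) (coords n)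

instance instFiniteDimensional (n : ℕ) : FiniteDimensional ℝ (RealClifford n) :=
  Module.Finite.of_basis (basis n)

/-- The generator `eᵢ` of `ℝₙ`. -/
def gen {n : ℕ} (i : Fin n) : RealClifford n :=
  CliffordAlgebra.ι (negSumSquares n) (Pi.single i 1)

/-- The defining relations `eᵢ eⱼ + eⱼ eᵢ = -2 δᵢⱼ`. -/
theorem gen_mul_gen_add_swap {n : ℕ} (i j : Fin n) :
    (gen i * gen j + gen j * gen i : RealClifford n) = if i = j then -2 else 0 := by
  rw [gen, gen, CliffordAlgebra.ι_mul_ι_add_swap, QuadraticMap.polar]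
  by_cases h : i = j
  · subst h
    simp [QuadraticMap.weightedSumSquares_apply, Pi.single_apply, mul_add,
      Finset.sum_add_distrib]
    norm_num [← map_ofNat (algebraMap ℝ (RealClifford n)), ← map_neg]
  · simp [QuadraticMap.weightedSumSquares_apply, Pi.single_apply, mul_add,
      Finset.sum_add_distrib, h, Ne.symm h]

end RealClifford

namespace PartialSlice

variable {p q : ℕ}

/-- The space `ℝ^(p+q+1)` of paravectors `x = ∑ xᵢ eᵢ`, with its splitting
`x = x_p + x_q`: the coordinates `x₀, …, x_p` carry the indices `Sum.inl i`, the coordinates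
`x_{p+1}, …, x_{p+q}` the indices `Sum.inr j`. -/
abbrev Paravector (p q : ℕ) : Type := EuclideanSpace ℝ (Fin (p + 1) ⊕ Fin q)

/-- The space `ℝ^(p+2)` of the variables `x' = (x_p, r)`. -/
abbrev Base (p : ℕ) : Type := EuclideanSpace ℝ (Fin (p + 1)) × ℝ

/-- The elements `e₀ = 1, e₁, …, e_p` (left) and `e_{p+1}, …, e_{p+q}` (right). -/
def unit (p q : ℕ) : Fin (p + 1) ⊕ Fin q → RealClifford (p + q)
  | Sum.inl i => Fin.cases 1 (fun k : Fin p => RealClifford.gen (Fin.castAdd q k)) i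
  | Sum.inr j => RealClifford.gen (Fin.natAdd p j)

/-- The point `x_p + x_q` of `ℝ^(p+q+1)`. -/
def join (xp : EuclideanSpace ℝ (Fin (p + 1))) (y : EuclideanSpace ℝ (Fin q)) :
    Paravector p q :=
  WithLp.toLp 2 (Sum.elim xp y)

/-- The component `x_p` of `x`. -/
def pPart (x : Paravector p q) : EuclideanSpace ℝ (Fin (p + 1)) :=
  WithLp.toLp 2 (fun i => x (Sum.inl i))

/-- The component `x_q` of `x`. -/
def qPart (x : Paravector p q) : EuclideanSpace ℝ (Fin q) :=
  WithLp.toLp 2 (fun j => x (Sum.inr j))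

/-- The `1`-vector `∑ⱼ yⱼ e_{p+j}` in the Clifford algebra. -/
def vec (p : ℕ) {q : ℕ} (y : EuclideanSpace ℝ (Fin q)) : RealClifford (p + q) :=
  ∑ j : Fin q, y j • unit p q (Sum.inr j)

/-- The reflected point `x_p - x_q`. -/
def reflect (x : Paravector p q) : Paravector p q :=
  join (pPart x) (-qPart x)

/-- The partially symmetric completion `Ω_D ⊆ ℝ^(p+q+1)` of `D ⊆ ℝ^(p+2)`. -/
def completion (q : ℕ) (D : Set (Base p)) : Set (Paravector p q) :=
  {x | ∃ (xp : EuclideanSpace ℝ (Fin (p + 1))) (r : ℝ) (w : EuclideanSpace ℝ (Fin q)),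
    0 ≤ r ∧ ‖w‖ = 1 ∧ (xp, r) ∈ D ∧ x = join xp (r • w)}

/-- The operator `D_x = ∑_{i=0}^{p+q} eᵢ ∂_{xᵢ}`. -/
def diracOp (f : Paravector p q → RealClifford (p + q)) (x : Paravector p q) :
    RealClifford (p + q) :=
  ∑ i : Fin (p + 1) ⊕ Fin q, unit p q i * fderiv ℝ f x (EuclideanSpace.single i 1)

/-- The operator `D_{x_p} = ∑_{i=0}^{p} eᵢ ∂_{xᵢ}` on functions of `x' = (x_p, r)`. -/
def diracP (F : Base p → RealClifford (p + q)) (x' : Base p) : RealClifford (p + q) :=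
  ∑ i : Fin (p + 1), unit p q (Sum.inl i) * fderiv ℝ F x' (EuclideanSpace.single i 1, 0)

/-- The conjugate operator `∑_{i=0}^{p} (conjugate of eᵢ) ∂_{xᵢ}` on functions of
`x' = (x_p, r)`; `star` is the Clifford conjugation. -/
def diracPConj (F : Base p → RealClifford (p + q)) (x' : Base p) : RealClifford (p + q) :=
  ∑ i : Fin (p + 1), star (unit p q (Sum.inl i)) * fderiv ℝ F x' (EuclideanSpace.single i 1, 0)

/-- The partial derivative `∂_r` on functions of `x' = (x_p, r)`. -/
def derivR (F : Base p → RealClifford (p + q)) (x' : Base p) : RealClifford (p + q) :=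
  fderiv ℝ F x' (0, 1)

/-- `f` is the generalized partial-slice function on `Ω_D` induced by `(F₁, F₂)`: `F₁` is even
and `F₂` is odd in `r`, and `f (x_p + r w) = F₁ (x_p, r) + w F₂ (x_p, r)` for all unit
`1`-vectors `w` of `ℝ^q`. -/
structure IsInducedBy (D : Set (Base p)) (F₁ F₂ : Base p → RealClifford (p + q))
    (f : Paravector p q → RealClifford (p + q)) : Prop where
  even : ∀ xp r, (xp, r) ∈ D → F₁ (xp, -r) = F₁ (xp, r)
  odd : ∀ xp r, (xp, r) ∈ D → F₂ (xp, -r) = -F₂ (xp, r)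
  eq : ∀ xp r, (xp, r) ∈ D → 0 ≤ r → ∀ w : EuclideanSpace ℝ (Fin q), ‖w‖ = 1 →
    f (join xp (r • w)) = F₁ (xp, r) + vec p w * F₂ (xp, r)

/-- `f` is generalized partial-slice regular of type `(p, q)` on `Ω_D`: it is induced by a pair
of class `C¹` on `D` that solves the generalized Cauchy-Riemann equations on `D`. -/
def IsRegular (D : Set (Base p)) (f : Paravector p q → RealClifford (p + q)) : Prop :=
  ∃ F₁ F₂ : Base p → RealClifford (p + q),
    IsInducedBy D F₁ F₂ f ∧ ContDiffOn ℝ 1 F₁ D ∧ ContDiffOn ℝ 1 F₂ D ∧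
      ∀ x' ∈ D, diracP F₁ x' - derivR F₂ x' = 0 ∧ diracPConj F₂ x' + derivR F₁ x' = 0

/-- The spherical derivative `x ↦ ½ x_q⁻¹ (f x - f (x_p - x_q))`, meaningful where `x_q ≠ 0`
(there `x_q` is invertible in the Clifford algebra). -/
def sphericalDeriv (f : Paravector p q → RealClifford (p + q)) (x : Paravector p q) :
    RealClifford (p + q) :=
  (1 / 2 : ℝ) • (Ring.inverse (vec p (qPart x)) * (f x - f (reflect x)))

end PartialSlice

end

/-! Put r = |x_q| and w = F₂ / r. Then f = F₁(x_p, r) + x_q w(x_p, r), and w(x_p, r) is the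
spherical derivative, so everything reduces to functions of (x_p, r).

Regularity. A C¹ solution of the Cauchy-Riemann system has harmonic components, at first only
weakly, because the system factors the Laplacian of ℝ^(p+2). Testing against a radial potential
yields a mean value property: near each point, a component is a multiple of its convolution with a
smooth radial kernel, hence smooth (`contDiffOn_of_cauchyRiemann`). Since F₂ is odd, w is smooth and
even by Hadamard's lemma (`contDiffOn_divLast`). Whitney's argument (`contDiffOn_comp_norm_of_even`)
then makes F₁(x_p, |x_q|) and w(x_p, |x_q|) smooth across the axis x_q = 0, which gives smoothness
of f and the extension of the spherical derivative.

Equations. Off the axis a direct computation gives D_x f = (1 - q) w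
(`diracOp_radial_add_vec_mul_radial`); by continuity this holds everywhere, and powers of the
Laplacian commute with D_x. Let B_k = Δ_{x_p} + ∂_r² + (k/r) ∂_r and S = r⁻¹ ∂_r. Harmonicity of F₂
= r w says B_2 w = 0, while Δ_x acts on functions of (x_p, |x_q|) as B_{q-1}. If B_k w = 0, then Δ_x
w = (q - 1 - k) S w, and B_{k+2} (S w) = 0 (`besselOp_invDerivR`). Each Laplacian therefore raises k
by 2, starting from k = 2; for odd q ≥ 3 the index reaches q - 1 and the function is annihilated
after exactly (q - 1)/2 Laplacians. For q = 1 the factor 1 - q vanishes instead. This is (i), and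
(ii) follows by applying the conjugate operator, since its product with D_x is Δ_x. -/

noncomputable section

open Set Filter Topology MeasureTheory

/-! ### Localization and integrals depending on a parameter -/

/-- Localization: a function of class `C^n` on an open set agrees near each point of that set with a
compactly supported function of class `C^n` on the whole space. -/
theorem ContDiffOn.exists_global_extension {E F : Type*} [NormedAddCommGroup E] [NormedSpace ℝ E]
    [FiniteDimensional ℝ E] [NormedAddCommGroup F] [NormedSpace ℝ F] {n : ℕ∞} {f : E → F}
    {U : Set E} (hU : IsOpen U) (hf : ContDiffOn ℝ n f U) {x₀ : E} (hx₀ : x₀ ∈ U) :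
    ∃ δ > 0, Metric.ball x₀ δ ⊆ U ∧ ∃ h : E → F, ContDiff ℝ n h ∧ HasCompactSupport h ∧
      EqOn h f (Metric.ball x₀ δ) := by
  obtain ⟨ε, hε, hεU⟩ := Metric.isOpen_iff.1 hU x₀ hx₀
  let χ : ContDiffBump x₀ := ⟨ε / 3, ε / 2, by positivity, by linarith⟩
  have hsub : Metric.closedBall x₀ (ε / 2) ⊆ U :=
    (Metric.closedBall_subset_ball (by linarith)).trans hεU
  refine ⟨ε / 3, by positivity, (Metric.ball_subset_ball (by linarith)).trans hεU,
    fun x => χ x • f x, ?_, ?_, ?_⟩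
  · rw [contDiff_iff_contDiffAt]
    intro x
    by_cases hx : x ∈ U
    · exact χ.contDiffAt.smul (hf.contDiffAt (hU.mem_nhds hx))
    -- Outside U the bump vanishes on a whole neighbourhood, so nothing is needed from f there.
    · have hx' : x ∈ (Metric.closedBall x₀ (ε / 2))ᶜ := fun h => hx (hsub h)
      have : (fun x => χ x • f x) =ᶠ[𝓝 x] fun _ => 0 := by
        filter_upwards [Metric.isClosed_closedBall.isOpen_compl.mem_nhds hx'] with y hy
        rw [χ.zero_of_le_dist (by simpa using (not_le.1 (by simpa using hy)).le), zero_smul]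
      exact contDiffAt_const.congr_of_eventuallyEq this
  · exact χ.hasCompactSupport.smul_right
  · intro x hx
    simp [χ.one_of_mem_closedBall (Metric.ball_subset_closedBall hx)]

/-- Differentiation under the integral sign, iterated. The codomain varies in the induction because
the derivative is an integral of the same kind with values in `E →L[ℝ] F`. The dominating constant
comes from compactness of [0, 1] times a closed ball. -/
theorem contDiff_intervalIntegral_unit_nat {E : Type} [NormedAddCommGroup E] [NormedSpace ℝ E]
    [FiniteDimensional ℝ E] (n : ℕ) : ∀ {F : Type} [NormedAddCommGroup F] [NormedSpace ℝ F]
    [CompleteSpace F] {h : ℝ × E → F}, ContDiff ℝ ∞ h →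
    ContDiff ℝ n (fun x => ∫ t in (0 : ℝ)..1, h (t, x)) := by
  induction n with
  | zero =>
    intro F _ _ _ h hh
    rw [Nat.cast_zero, contDiff_zero]
    exact intervalIntegral.continuous_parametric_intervalIntegral_of_continuous'
      (f := fun x t => h (t, x)) (hh.continuous.comp continuous_swap) 0 1
  | succ n ih =>
    intro F _ _ _ h hh
    let h' : ℝ × E → E →L[ℝ] F := fun z => (fderiv ℝ h z).comp (.inr ℝ ℝ E)
    have hh' : ContDiff ℝ ∞ h' :=
      (hh.fderiv_right (m := ∞) (by simp)).clm_comp contDiff_const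
    have hder : ∀ t x, HasFDerivAt (fun x => h (t, x)) (h' (t, x)) x := fun t x =>
      ((hh.differentiable (by simp)).differentiableAt.hasFDerivAt (x := (t, x))).comp x
        (hasFDerivAt_prodMk_right t x)
    have key : ∀ x, HasFDerivAt (fun x => ∫ t in (0 : ℝ)..1, h (t, x))
        (∫ t in (0 : ℝ)..1, h' (t, x)) x := by
      intro x₀
      obtain ⟨C, hC⟩ := ((isCompact_Icc (a := (0 : ℝ)) (b := 1)).prod
        (isCompact_closedBall x₀ 1)).exists_bound_of_continuousOn hh'.continuous.continuousOn
      have cont : ∀ x, Continuous fun t => h (t, x) := fun x =>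
        hh.continuous.comp (continuous_id.prodMk continuous_const)
      have cont' : ∀ x, Continuous fun t => h' (t, x) := fun x =>
        hh'.continuous.comp (continuous_id.prodMk continuous_const)
      refine intervalIntegral.hasFDerivAt_integral_of_dominated_of_fderiv_le
        (F := fun x t => h (t, x)) (F' := fun x t => h' (t, x)) (bound := fun _ => C)
        (Metric.closedBall_mem_nhds x₀ one_pos)
        (Eventually.of_forall fun x => (cont x).aestronglyMeasurable)
        ((cont x₀).intervalIntegrable _ _) (cont' x₀).aestronglyMeasurable
        (Eventually.of_forall fun t ht x hx => hC (t, x) ⟨?_, hx⟩)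
        intervalIntegrable_const (Eventually.of_forall fun t _ x _ => hder t x)
      rw [uIoc_of_le zero_le_one] at ht
      exact ⟨ht.1.le, ht.2⟩
    rw [Nat.cast_add, Nat.cast_one, contDiff_succ_iff_hasFDerivAt]
    exact ⟨_, ih hh', key⟩

theorem contDiff_intervalIntegral_unit {E : Type} [NormedAddCommGroup E] [NormedSpace ℝ E]
    [FiniteDimensional ℝ E] {F : Type} [NormedAddCommGroup F] [NormedSpace ℝ F]
    [CompleteSpace F] {h : ℝ × E → F} (hh : ContDiff ℝ ∞ h) :
    ContDiff ℝ ∞ (fun x => ∫ t in (0 : ℝ)..1, h (t, x)) :=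
  contDiff_infty.2 fun n => contDiff_intervalIntegral_unit_nat n hh

/-! ### Division by r: Hadamard's lemma -/

/-- The quotient of `k` by the last variable `r`, extended by the partial derivative `∂_r k` to the
hyperplane `r = 0`. -/
def divLast {X F : Type*} [NormedAddCommGroup X] [NormedSpace ℝ X] [NormedAddCommGroup F]
    [NormedSpace ℝ F] (k : X × ℝ → F) (z : X × ℝ) : F :=
  if z.2 = 0 then fderiv ℝ k z (0, 1) else z.2⁻¹ • k z

section DivLast

variable {X F : Type} [NormedAddCommGroup X] [NormedSpace ℝ X] [NormedAddCommGroup F]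
  [NormedSpace ℝ F]

theorem smul_divLast {k : X × ℝ → F} {z : X × ℝ} (hk : z.2 = 0 → k z = 0) :
    z.2 • divLast k z = k z := by
  by_cases h : z.2 = 0
  · simp [h, hk h]
  · simp [divLast, h]

theorem divLast_of_ne {k : X × ℝ → F} {z : X × ℝ} (hz : z.2 ≠ 0) :
    divLast k z = z.2⁻¹ • k z := by
  simp [divLast, hz]

/-- The fundamental theorem of calculus along t ↦ (x, t r). At r = 0 the integrand is constant,
which dictates the value ∂_r k chosen there. -/
theorem divLast_eq_integral [CompleteSpace F] {k : X × ℝ → F} (hk : ContDiff ℝ ∞ k) {z : X × ℝ}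
    (hz : k (z.1, 0) = 0) :
    divLast k z = ∫ t in (0 : ℝ)..1, fderiv ℝ k (z.1, t * z.2) (0, 1) := by
  by_cases h : z.2 = 0
  · obtain ⟨x, r⟩ := z
    simp only at h
    simp [divLast, h]
  · have hd : ∀ t, HasDerivAt (fun t => k (z.1, t * z.2))
        (z.2 • fderiv ℝ k (z.1, t * z.2) (0, 1)) t := by
      intro t
      have h1 : HasDerivAt (fun t : ℝ => (z.1, t * z.2)) ((0 : X), z.2) t :=
        (hasDerivAt_const t z.1).prodMk (by simpa using (hasDerivAt_id t).mul_const z.2)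
      have h2 := ((hk.differentiable (by simp)).differentiableAt.hasFDerivAt
        (x := (z.1, t * z.2))).comp_hasDerivAt t h1
      rw [← map_smul]
      simpa [Function.comp_def] using h2
    have hc : Continuous fun t : ℝ => z.2 • fderiv ℝ k (z.1, t * z.2) (0, 1) :=
      (((hk.continuous_fderiv (by simp)).comp (by fun_prop)).clm_apply
        continuous_const).const_smul _
    have := intervalIntegral.integral_eq_sub_of_hasDerivAt (fun t _ => hd t)
      (hc.intervalIntegrable 0 1)
    rw [intervalIntegral.integral_smul] at this
    simp only [one_mul, zero_mul, hz, sub_zero] at this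
    rw [divLast_of_ne h, inv_smul_eq_iff₀ h, this]

/-- **Hadamard's lemma**: the quotient by `r` of a smooth function that vanishes for `r = 0` is
smooth. -/
theorem contDiffOn_divLast [FiniteDimensional ℝ X] [CompleteSpace F] {D : Set (X × ℝ)}
    (hD : IsOpen D) {k : X × ℝ → F} (hk : ContDiffOn ℝ ∞ k D)
    (h0 : ∀ z ∈ D, z.2 = 0 → k z = 0) : ContDiffOn ℝ ∞ (divLast k) D := by
  rintro ⟨x₀, r₀⟩ hz
  apply ContDiffAt.contDiffWithinAt
  by_cases hr : r₀ = 0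
  · subst hr
    obtain ⟨δ, hδ, hsub, h, hh, -, heq⟩ := hk.exists_global_extension hD hz
    have hint : ContDiff ℝ ∞ fun z : X × ℝ =>
        ∫ t in (0 : ℝ)..1, fderiv ℝ h (z.1, t * z.2) (0, 1) := by
      refine contDiff_intervalIntegral_unit
        (h := fun w : ℝ × X × ℝ => fderiv ℝ h (w.2.1, w.1 * w.2.2) (0, 1)) ?_
      exact ((hh.fderiv_right (m := ∞) (by simp)).comp (by fun_prop)).clm_apply contDiff_const
    refine hint.contDiffAt.congr_of_eventuallyEq ?_
    filter_upwards [Metric.ball_mem_nhds (x₀, (0 : ℝ)) hδ] with z hz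
    -- In the sup norm of the product, replacing r by 0 does not leave a ball centred on r = 0.
    have hz0 : (z.1, (0 : ℝ)) ∈ Metric.ball (x₀, (0 : ℝ)) δ := by
      rw [Metric.mem_ball, Prod.dist_eq, max_lt_iff] at hz ⊢
      exact ⟨hz.1, by simpa using hδ⟩
    have e1 : divLast k z = divLast h z := by
      unfold divLast
      rw [heq hz, (heq.eventuallyEq_of_mem (Metric.isOpen_ball.mem_nhds hz)).fderiv_eq]
    rw [e1, divLast_eq_integral hh]
    rw [heq hz0, h0 _ (hsub hz0) rfl]
  · have : divLast k =ᶠ[𝓝 (x₀, r₀)] fun z => z.2⁻¹ • k z := by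
      filter_upwards [(isOpen_ne_fun continuous_snd continuous_const).mem_nhds
        (show (x₀, r₀).2 ≠ 0 from hr)] with z hz using divLast_of_ne hz
    exact ((contDiffAt_snd.inv hr).smul (hk.contDiffAt (hD.mem_nhds hz))).congr_of_eventuallyEq this

end DivLast

/-! ### Smoothness of even functions of the norm -/

theorem eq_zero_of_odd {X F : Type} [NormedAddCommGroup F] [NormedSpace ℝ F]
    {k : X × ℝ → F} {D : Set (X × ℝ)}
    (hodd : ∀ x r, (x, r) ∈ D → k (x, -r) = -k (x, r)) {z : X × ℝ} (hz : z ∈ D) (h0 : z.2 = 0) :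
    k z = 0 := by
  obtain ⟨x, r⟩ := z
  simp only at h0
  subst h0
  have := hodd x 0 hz
  rw [neg_zero] at this
  have h2 : (2 : ℝ) • k (x, 0) = 0 := by
    rw [two_smul]
    nth_rewrite 1 [this]
    exact neg_add_cancel _
  exact (smul_eq_zero.1 h2).resolve_left two_ne_zero

section EvenFunctions

variable {X Y F : Type} [NormedAddCommGroup X] [NormedSpace ℝ X] [NormedAddCommGroup Y]
  [InnerProductSpace ℝ Y] [NormedAddCommGroup F] [NormedSpace ℝ F]

theorem fderiv_apply_neg_of_even {D : Set (X × ℝ)} (hD : IsOpen D)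
    (hsymm : ∀ x r, (x, r) ∈ D → (x, -r) ∈ D) {g : X × ℝ → F} (hg : DifferentiableOn ℝ g D)
    (heven : ∀ x r, (x, r) ∈ D → g (x, -r) = g (x, r)) {x : X} {r : ℝ} (hz : (x, r) ∈ D)
    (a : X) (s : ℝ) : fderiv ℝ g (x, -r) (a, -s) = fderiv ℝ g (x, r) (a, s) := by
  let σ : X × ℝ →L[ℝ] X × ℝ := (ContinuousLinearMap.fst ℝ X ℝ).prod
    (-ContinuousLinearMap.snd ℝ X ℝ)
  have h1 : HasFDerivAt (g ∘ σ) ((fderiv ℝ g (σ (x, r))).comp σ) (x, r) :=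
    ((hg.differentiableAt (hD.mem_nhds (hsymm x r hz))).hasFDerivAt).comp (x, r) σ.hasFDerivAt
  have h2 : g ∘ σ =ᶠ[𝓝 (x, r)] g := by
    filter_upwards [hD.mem_nhds hz] with w hw using heven w.1 w.2 hw
  rw [← h2.fderiv_eq, h1.fderiv]
  simp [σ]

theorem fderiv_apply_last_neg_of_even {D : Set (X × ℝ)} (hD : IsOpen D)
    (hsymm : ∀ x r, (x, r) ∈ D → (x, -r) ∈ D) {g : X × ℝ → F} (hg : DifferentiableOn ℝ g D)
    (heven : ∀ x r, (x, r) ∈ D → g (x, -r) = g (x, r)) {x : X} {r : ℝ} (hz : (x, r) ∈ D) :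
    fderiv ℝ g (x, -r) (0, 1) = -fderiv ℝ g (x, r) (0, 1) := by
  rw [← fderiv_apply_neg_of_even hD hsymm hg heven hz, ← map_neg]
  simp

theorem divLast_even_of_odd {k : X × ℝ → F} {D : Set (X × ℝ)}
    (hodd : ∀ x r, (x, r) ∈ D → k (x, -r) = -k (x, r)) {x : X} {r : ℝ} (hz : (x, r) ∈ D) :
    divLast k (x, -r) = divLast k (x, r) := by
  by_cases hr : r = 0
  · simp [hr]
  · rw [divLast_of_ne (by simpa using hr), divLast_of_ne (by simpa using hr), hodd x r hz]
    simp [inv_neg]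

/-- The chain rule for `g (x, ‖y‖)` at the points with `y ≠ 0`. -/
theorem hasFDerivAt_comp_norm_of_ne {g : X × ℝ → F} {z : X × Y}
    (hg : DifferentiableAt ℝ g (z.1, ‖z.2‖)) (hz : z.2 ≠ 0) :
    HasFDerivAt (fun z : X × Y => g (z.1, ‖z.2‖)) ((fderiv ℝ g (z.1, ‖z.2‖)).comp
      ((ContinuousLinearMap.fst ℝ X Y).prod
        ((‖z.2‖⁻¹ • innerSL ℝ z.2).comp (.snd ℝ X Y)))) z := by
  have hn : ‖z.2‖ ≠ 0 := norm_ne_zero_iff.2 hz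
  have h1 : HasFDerivAt (fun v : Y => ‖v‖) (‖z.2‖⁻¹ • innerSL ℝ z.2) z.2 := by
    have := ((hasStrictFDerivAt_norm_sq z.2).hasFDerivAt).sqrt (by positivity)
    simp only [Real.sqrt_sq (norm_nonneg _)] at this
    convert this using 1
    ext v
    simp
    field_simp
  have h2 : HasFDerivAt (fun z : X × Y => (z.1, ‖z.2‖)) _ z :=
    hasFDerivAt_fst.prodMk (h1.comp z hasFDerivAt_snd)
  exact HasFDerivAt.comp (g := g) z hg.hasFDerivAt h2

/-- Away from y = 0 the radial term is r⁻¹ ∂_r g times the differential of |y|²/2. Writing the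
coefficient with `divLast` gives one formula valid on the axis too, whose coefficients are again
even functions of r; this is what lets the smoothness induction close. -/
theorem hasFDerivAt_comp_norm_of_even {D : Set (X × ℝ)} (hD : IsOpen D)
    (hsymm : ∀ x r, (x, r) ∈ D → (x, -r) ∈ D) {g : X × ℝ → F} (hg : DifferentiableOn ℝ g D)
    (heven : ∀ x r, (x, r) ∈ D → g (x, -r) = g (x, r)) {z : X × Y} (hz : (z.1, ‖z.2‖) ∈ D) :
    HasFDerivAt (fun z : X × Y => g (z.1, ‖z.2‖))
      (((fderiv ℝ g (z.1, ‖z.2‖)).comp (.inl ℝ X ℝ)).comp (.fst ℝ X Y) +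
        ((innerSL ℝ z.2).comp (.snd ℝ X Y)).smulRight
          (divLast (fun w => fderiv ℝ g w (0, 1)) (z.1, ‖z.2‖))) z := by
  have hgz := (hg.differentiableAt (hD.mem_nhds hz)).hasFDerivAt
  obtain ⟨x, y⟩ := z
  simp only at hz hgz ⊢
  by_cases hy : y = 0
  · subst hy
    rw [norm_zero] at hz hgz ⊢
    have h0 : fderiv ℝ g (x, 0) (0, 1) = 0 :=
      eq_zero_of_odd (k := fun w => fderiv ℝ g w (0, 1)) (D := D)
        (fun x r h => fderiv_apply_last_neg_of_even hD hsymm hg heven h) hz rfl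
    -- As ∂_r g vanishes on the axis, the linear part ignores r, and the non-differentiability of
    -- |y| at 0 does no harm.
    have hL : fderiv ℝ g (x, 0) = ((fderiv ℝ g (x, 0)).comp (.inl ℝ X ℝ)).comp (.fst ℝ X ℝ) := by
      ext v
      · simp
      · exact h0.trans (map_zero (fderiv ℝ g (x, 0))).symm
    rw [hasFDerivAt_iff_isLittleO_nhds_zero] at hgz ⊢
    have ht : Tendsto (fun v : X × Y => (v.1, ‖v.2‖)) (𝓝 0) (𝓝 0) := by
      have : Continuous (fun v : X × Y => (v.1, ‖v.2‖)) := by fun_prop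
      have h := this.tendsto 0
      rwa [show ((0 : X × Y).1, ‖(0 : X × Y).2‖) = 0 from Prod.ext rfl norm_zero] at h
    have := (hgz.comp_tendsto ht)
    refine (this.congr_left ?_).trans_isBigO (Asymptotics.isBigO_of_le _ ?_)
    · intro v
      simp only [Function.comp_apply]
      rw [hL]
      simp
    · intro v
      simp [Prod.norm_def]
  · have hn : ‖y‖ ≠ 0 := norm_ne_zero_iff.2 hy
    refine (hasFDerivAt_comp_norm_of_ne (z := (x, y)) hgz.differentiableAt hy).congr_fderiv ?_
    rw [divLast_of_ne hn]
    ext v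
    · simp
    · have h3 : fderiv ℝ g (x, ‖y‖) (0, ‖y‖⁻¹ * inner ℝ y v) =
          (‖y‖⁻¹ * inner ℝ y v) • fderiv ℝ g (x, ‖y‖) (0, 1) := by
        rw [← map_smul, Prod.smul_mk, smul_zero, smul_eq_mul, mul_one]
      simp only [ContinuousLinearMap.comp_apply, _root_.add_apply,
        ContinuousLinearMap.smulRight_apply, ContinuousLinearMap.prod_apply,
        ContinuousLinearMap.inr_apply, ContinuousLinearMap.inl_apply,
        ContinuousLinearMap.coe_fst', ContinuousLinearMap.coe_snd',
        _root_.smul_apply, innerSL_apply_apply, smul_eq_mul, h3]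
      rw [show ((0 : X), (0 : ℝ)) = 0 from rfl, map_zero, zero_add, smul_smul, mul_comm]

variable [FiniteDimensional ℝ X]

/-- Both coefficients of the derivative, ∂_x g and r⁻¹ ∂_r g, are smooth and even, so the induction
hypothesis applies to them; their codomains differ from that of g, hence the quantification over F.
-/
theorem contDiffOn_comp_norm_of_even_nat {D : Set (X × ℝ)} (hD : IsOpen D)
    (hsymm : ∀ x r, (x, r) ∈ D → (x, -r) ∈ D) (n : ℕ) :
    ∀ {F : Type} [NormedAddCommGroup F] [NormedSpace ℝ F] [CompleteSpace F]
      {g : X × ℝ → F}, ContDiffOn ℝ ∞ g D → (∀ x r, (x, r) ∈ D → g (x, -r) = g (x, r)) →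
      ContDiffOn ℝ n (fun z : X × Y => g (z.1, ‖z.2‖)) {z | (z.1, ‖z.2‖) ∈ D} := by
  have hc : Continuous fun z : X × Y => (z.1, ‖z.2‖) := by fun_prop
  have hO : IsOpen {z : X × Y | (z.1, ‖z.2‖) ∈ D} := hD.preimage hc
  induction n with
  | zero =>
    intro F _ _ _ g hg heven
    rw [Nat.cast_zero, contDiffOn_zero]
    exact hg.continuousOn.comp hc.continuousOn fun z hz => hz
  | succ n ih =>
    intro F _ _ _ g hg heven
    have hgd : DifferentiableOn ℝ g D := hg.differentiableOn (by simp)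
    have hfd : ContDiffOn ℝ ∞ (fderiv ℝ g) D := hg.fderiv_of_isOpen hD (by simp)
    have hder := fun (z : X × Y) (hz : (z.1, ‖z.2‖) ∈ D) =>
      hasFDerivAt_comp_norm_of_even hD hsymm hgd heven hz
    have hodd : ∀ x r, (x, r) ∈ D → fderiv ℝ g (x, -r) (0, 1) = -fderiv ℝ g (x, r) (0, 1) :=
      fun x r h => fderiv_apply_last_neg_of_even hD hsymm hgd heven h
    have hk : ContDiffOn ℝ ∞ (fun w => fderiv ℝ g w (0, 1)) D := hfd.clm_apply contDiffOn_const
    rw [Nat.cast_add, Nat.cast_one, contDiffOn_succ_iff_fderiv_of_isOpen hO]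
    refine ⟨fun z hz => (hder z hz).differentiableAt.differentiableWithinAt, by simp, ?_⟩
    refine ContDiffOn.congr ?_ fun z hz => (hder z hz).fderiv
    refine ContDiffOn.add (ContDiffOn.clm_comp ?_ contDiffOn_const) (ContDiffOn.smulRight ?_ ?_)
    · refine ih (g := fun w => (fderiv ℝ g w).comp (.inl ℝ X ℝ))
        (hfd.clm_comp contDiffOn_const) fun x r h => ?_
      ext a
      simpa using fderiv_apply_neg_of_even hD hsymm hgd heven h a 0
    · exact (((innerSL ℝ).contDiff.comp contDiff_snd).clm_comp contDiff_const).contDiffOn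
    · exact ih (contDiffOn_divLast hD hk fun z hz h0 =>
          eq_zero_of_odd (k := fun w => fderiv ℝ g w (0, 1)) hodd hz h0)
        fun x r h => divLast_even_of_odd (k := fun w => fderiv ℝ g w (0, 1)) hodd h

/-- **Whitney**: if `g (x, r)` is smooth and even in `r`, then `g (x, ‖y‖)` is smooth. -/
theorem contDiffOn_comp_norm_of_even [CompleteSpace F] {D : Set (X × ℝ)} (hD : IsOpen D)
    (hsymm : ∀ x r, (x, r) ∈ D → (x, -r) ∈ D) {g : X × ℝ → F} (hg : ContDiffOn ℝ ∞ g D)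
    (heven : ∀ x r, (x, r) ∈ D → g (x, -r) = g (x, r)) :
    ContDiffOn ℝ ∞ (fun z : X × Y => g (z.1, ‖z.2‖)) {z | (z.1, ‖z.2‖) ∈ D} :=
  contDiffOn_infty.2 fun n => contDiffOn_comp_norm_of_even_nat hD hsymm n hg heven

end EvenFunctions

/-! ### Weak harmonicity from a first order system -/

section IntegrationByParts

variable {V F : Type} [NormedAddCommGroup V] [NormedSpace ℝ V]
  [MeasurableSpace V] [BorelSpace V] {μ : Measure V}
  [NormedAddCommGroup F] [NormedSpace ℝ F]

theorem integrable_fderiv_smul_fderiv [IsFiniteMeasureOnCompacts μ] {H : V → ℝ}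
    (hH : ContDiff ℝ ∞ H)
    (hHc : HasCompactSupport H) {v : V → F} (hv : ContDiff ℝ 1 v) (a b : V) :
    Integrable (fun y => fderiv ℝ H y a • fderiv ℝ v y b) μ :=
  (((hH.continuous_fderiv (by simp)).clm_apply continuous_const).smul
    ((hv.continuous_fderiv (by simp)).clm_apply continuous_const)).integrable_of_hasCompactSupport
    ((hHc.fderiv_apply (𝕜 := ℝ) a).smul_right)

/-- Since v is only C¹, its mixed second derivatives are unavailable. Integrating by parts moves the
second derivative to the test function H, where symmetry holds. -/
theorem integral_fderiv_smul_fderiv_comm [FiniteDimensional ℝ V] [μ.IsAddHaarMeasure]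
    [CompleteSpace F] {H : V → ℝ} (hH : ContDiff ℝ ∞ H)
    (hHc : HasCompactSupport H) {v : V → F} (hv : ContDiff ℝ 1 v) (a b : V) :
    ∫ y, fderiv ℝ H y a • fderiv ℝ v y b ∂μ = ∫ y, fderiv ℝ H y b • fderiv ℝ v y a ∂μ := by
  have hd : ∀ c, ContDiff ℝ ∞ fun y => fderiv ℝ H y c := fun c =>
    (hH.fderiv_right (m := ∞) (by simp)).clm_apply contDiff_const
  have hdc : ∀ c, HasCompactSupport fun y => fderiv ℝ H y c := fun c => hHc.fderiv_apply (𝕜 := ℝ) c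
  have key : ∀ a b, ∫ y, fderiv ℝ H y a • fderiv ℝ v y b ∂μ =
      -∫ y, fderiv ℝ (fun y => fderiv ℝ H y a) y b • v y ∂μ := fun a b => by
    refine integral_smul_fderiv_eq_neg_fderiv_smul_of_integrable ?_
      (integrable_fderiv_smul_fderiv hH hHc hv a b) ?_
      (fun y _ => ((hd a).differentiable (by simp)).differentiableAt)
      (fun y _ => (hv.differentiable (by simp)).differentiableAt)
    · exact ((((hd a).continuous_fderiv (by simp)).clm_apply continuous_const).smul
        hv.continuous).integrable_of_hasCompactSupport
        (((hdc a).fderiv_apply (𝕜 := ℝ) b).smul_right)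
    · exact ((hd a).continuous.smul hv.continuous).integrable_of_hasCompactSupport
        (hdc a).smul_right
  rw [key, key b a]
  congr 2
  ext y
  have hs : IsSymmSndFDerivAt ℝ H y := hH.contDiffAt.isSymmSndFDerivAt (by
    simpa using ENat.LEInfty.out)
  have hdd : DifferentiableAt ℝ (fderiv ℝ H) y :=
    ((hH.fderiv_right (m := ∞) (by simp)).differentiable (by simp)).differentiableAt
  rw [fderiv_clm_apply hdd (by fun_prop), fderiv_clm_apply hdd (by fun_prop)]
  simp [hs.eq a b]

end IntegrationByParts

/-- Factorization of a sum of squares by operators with `aᵢ bⱼ + aⱼ bᵢ = 2 δᵢⱼ`. -/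
theorem sum_sum_apply_of_symm {ι F : Type} [Fintype ι] [DecidableEq ι] [NormedAddCommGroup F]
    [NormedSpace ℝ F] {a b : ι → F →L[ℝ] F}
    (hab : ∀ i j u, a i (b j u) + a j (b i u) = if i = j then (2 : ℝ) • u else 0)
    {M : ι → ι → F} (hM : ∀ i j, M i j = M j i) :
    ∑ i, ∑ j, a i (b j (M i j)) = ∑ i, M i i := by
  have h3 : ∑ i, ∑ j, a i (b j (M i j)) = ∑ i, ∑ j, a j (b i (M i j)) := by
    rw [Finset.sum_comm]
    exact Finset.sum_congr rfl fun i _ => Finset.sum_congr rfl fun j _ => by rw [hM]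
  have h4 : (2 : ℝ) • ∑ i, ∑ j, a i (b j (M i j)) = (2 : ℝ) • ∑ i, M i i := by
    rw [two_smul]
    nth_rewrite 2 [h3]
    simp_rw [← Finset.sum_add_distrib, hab]
    simp [Finset.smul_sum]
  exact smul_right_injective F two_ne_zero h4

section WeakHarmonic

variable {ι F : Type} [Fintype ι] [DecidableEq ι] [NormedAddCommGroup F] [NormedSpace ℝ F]
  {μ : Measure (EuclideanSpace ℝ ι × ℝ)} [μ.IsAddHaarMeasure]

/-- Solutions of a generalized Cauchy-Riemann system are weakly harmonic. -/
theorem sum_integral_fderiv_smul_fderiv_eq_zero [CompleteSpace F] {a b : ι → F →L[ℝ] F}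
    (hab : ∀ i j u, a i (b j u) + a j (b i u) = if i = j then (2 : ℝ) • u else 0)
    {H : EuclideanSpace ℝ ι × ℝ → ℝ} (hH : ContDiff ℝ ∞ H) (hHc : HasCompactSupport H)
    {v₁ v₂ : EuclideanSpace ℝ ι × ℝ → F} (hv₁ : ContDiff ℝ 1 v₁) (hv₂ : ContDiff ℝ 1 v₂)
    (h1 : ∀ y ∈ tsupport H, ∑ i, b i (fderiv ℝ v₁ y (EuclideanSpace.single i 1, 0)) =
      fderiv ℝ v₂ y (0, 1))
    (h2 : ∀ y ∈ tsupport H, ∑ i, a i (fderiv ℝ v₂ y (EuclideanSpace.single i 1, 0)) =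
      -fderiv ℝ v₁ y (0, 1)) :
    ∑ i, ∫ y, fderiv ℝ H y (EuclideanSpace.single i 1, 0) •
        fderiv ℝ v₁ y (EuclideanSpace.single i 1, 0) ∂μ +
      ∫ y, fderiv ℝ H y (0, 1) • fderiv ℝ v₁ y (0, 1) ∂μ = 0 := by
  set e : ι → EuclideanSpace ℝ ι × ℝ := fun i => (EuclideanSpace.single i 1, 0)
  set I : (EuclideanSpace ℝ ι × ℝ) → (EuclideanSpace ℝ ι × ℝ) → F := fun c d =>
    ∫ y, fderiv ℝ H y c • fderiv ℝ v₁ y d ∂μ with hI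
  set J : (EuclideanSpace ℝ ι × ℝ) → (EuclideanSpace ℝ ι × ℝ) → F := fun c d =>
    ∫ y, fderiv ℝ H y c • fderiv ℝ v₂ y d ∂μ with hJ
  have supp : ∀ y c, y ∉ tsupport H → fderiv ℝ H y c = 0 := fun y c hy => by
    rw [image_eq_zero_of_notMem_tsupport (f := fderiv ℝ H)
      (fun h => hy (tsupport_fderiv_subset ℝ h)), zero_apply]
  have hsI : ∀ c, ∑ i, b i (I c (e i)) = J c (0, 1) := fun c => by
    simp only [hI, hJ]
    simp_rw [← ContinuousLinearMap.integral_comp_comm _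
      (integrable_fderiv_smul_fderiv hH hHc hv₁ _ _)]
    rw [← integral_finsetSum _ fun i _ =>
      (b i).integrable_comp (integrable_fderiv_smul_fderiv hH hHc hv₁ _ _)]
    refine integral_congr_ae (Eventually.of_forall fun y => ?_)
    simp only [map_smul, ← Finset.smul_sum]
    by_cases hy : y ∈ tsupport H
    · rw [h1 y hy]
    · simp [supp y _ hy]
  have hsJ : ∀ c, ∑ i, a i (J c (e i)) = -I c (0, 1) := fun c => by
    simp only [hI, hJ]
    simp_rw [← ContinuousLinearMap.integral_comp_comm _
      (integrable_fderiv_smul_fderiv hH hHc hv₂ _ _)]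
    rw [← integral_finsetSum _ fun i _ =>
      (a i).integrable_comp (integrable_fderiv_smul_fderiv hH hHc hv₂ _ _), ← integral_neg]
    refine integral_congr_ae (Eventually.of_forall fun y => ?_)
    simp only [map_smul, ← Finset.smul_sum]
    by_cases hy : y ∈ tsupport H
    · rw [h2 y hy, smul_neg]
    · simp [supp y _ hy]
  have hsym : ∑ i, ∑ j, a i (b j (I (e i) (e j))) = ∑ i, I (e i) (e i) :=
    sum_sum_apply_of_symm hab fun i j => integral_fderiv_smul_fderiv_comm hH hHc hv₁ _ _
  have hcomm : ∀ i, J (e i) (0, 1) = J (0, 1) (e i) := fun i =>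
    integral_fderiv_smul_fderiv_comm hH hHc hv₂ _ _
  change ∑ i, I (e i) (e i) + I (0, 1) (0, 1) = 0
  -- The chain is ∑ I(eᵢ, eᵢ) = ∑ aᵢ bⱼ I(eᵢ, eⱼ) = ∑ aᵢ J(eᵢ, ∂_r) = ∑ aᵢ J(∂_r, eᵢ) = -I(∂_r,
  -- ∂_r), using the two equations and the exchange of directions.
  rw [← hsym]
  simp_rw [← map_sum, hsI, hcomm, hsJ]
  simp

end WeakHarmonic

/-! ### Radial kernels and their potentials -/

section RadialKernel

/-- The primitive of `s ↦ -smoothTransition (c - s)` that vanishes at `c`. -/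
def transitionPrimitive (c s : ℝ) : ℝ := ∫ t in s..c, Real.smoothTransition (c - t)

theorem hasDerivAt_transitionPrimitive (c s : ℝ) :
    HasDerivAt (transitionPrimitive c) (-Real.smoothTransition (c - s)) s := by
  have hc : Continuous fun t : ℝ => Real.smoothTransition (c - t) :=
    Real.smoothTransition.continuous.comp (by fun_prop)
  exact intervalIntegral.integral_hasDerivAt_left (hc.intervalIntegrable _ _)
    (hc.stronglyMeasurableAtFilter _ _) hc.continuousAt

theorem contDiff_smoothTransition_const_sub (c : ℝ) :
    ContDiff ℝ ∞ fun s : ℝ => Real.smoothTransition (c - s) :=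
  Real.smoothTransition.contDiff.comp (contDiff_const.sub contDiff_id)

theorem contDiff_transitionPrimitive (c : ℝ) : ContDiff ℝ ∞ (transitionPrimitive c) := by
  rw [contDiff_infty_iff_deriv]
  refine ⟨fun s => (hasDerivAt_transitionPrimitive c s).differentiableAt, ?_⟩
  rw [show deriv (transitionPrimitive c) = fun s => -Real.smoothTransition (c - s) from
    funext fun s => (hasDerivAt_transitionPrimitive c s).deriv]
  exact (contDiff_smoothTransition_const_sub c).neg

theorem transitionPrimitive_eq_zero {c s : ℝ} (h : c ≤ s) : transitionPrimitive c s = 0 := by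
  rw [transitionPrimitive, intervalIntegral.integral_congr (g := fun _ => 0)]
  · simp
  · intro t ht
    rw [uIcc_of_ge h] at ht
    exact Real.smoothTransition.zero_of_nonpos (by linarith [ht.1])

variable {ι : Type} [Fintype ι]

/-- The square `|x|² + r²` of the Euclidean norm on `ℝ^ι × ℝ`. -/
def normSqLast (z : EuclideanSpace ℝ ι × ℝ) : ℝ := ‖z.1‖ ^ 2 + z.2 ^ 2

theorem contDiff_normSqLast : ContDiff ℝ ∞ (normSqLast (ι := ι)) :=
  (contDiff_fst.norm_sq ℝ).add (contDiff_snd.pow 2)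

theorem hasFDerivAt_normSqLast (z : EuclideanSpace ℝ ι × ℝ) :
    HasFDerivAt normSqLast ((2 : ℝ) • ((innerSL ℝ z.1).comp (.fst ℝ _ _) +
      z.2 • .snd ℝ _ _)) z := by
  have h1 := (hasStrictFDerivAt_norm_sq z.1).hasFDerivAt.comp z hasFDerivAt_fst
  have h2 : HasFDerivAt (fun z : EuclideanSpace ℝ ι × ℝ => z.2 ^ 2) _ z :=
    (hasFDerivAt_snd (𝕜 := ℝ) (p := z)).pow 2
  refine (h1.add h2).congr_fderiv ?_
  ext v <;> simp

/-- The product carries the sup norm, whereas the kernel must be radial for the Euclidean norm; this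
converts Euclidean supports into sup norm balls. -/
theorem norm_le_of_normSqLast_le {z : EuclideanSpace ℝ ι × ℝ} {ρ : ℝ} (hρ : 0 ≤ ρ)
    (h : normSqLast z ≤ ρ ^ 2) : ‖z‖ ≤ ρ := by
  unfold normSqLast at h
  rw [Prod.norm_def, max_le_iff, Real.norm_eq_abs]
  exact ⟨abs_le_of_sq_le_sq' (by nlinarith [sq_nonneg z.2]) hρ |>.2,
    abs_le_of_sq_le_sq (by nlinarith [sq_nonneg ‖z.1‖]) hρ⟩

/-- A smooth radial function on `ℝ^ι × ℝ`, supported in the Euclidean ball of radius `ρ`. -/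
def radialKernel (ρ : ℝ) (z : EuclideanSpace ℝ ι × ℝ) : ℝ :=
  Real.smoothTransition (ρ ^ 2 - normSqLast z)

theorem contDiff_radialKernel (ρ : ℝ) : ContDiff ℝ ∞ (radialKernel (ι := ι) ρ) :=
  (contDiff_smoothTransition_const_sub (ρ ^ 2)).comp contDiff_normSqLast

theorem radialKernel_eq_zero {ρ : ℝ} (hρ : 0 ≤ ρ) {z : EuclideanSpace ℝ ι × ℝ} (h : ρ < ‖z‖) :
    radialKernel ρ z = 0 := by
  refine Real.smoothTransition.zero_of_nonpos ?_
  by_contra! h'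
  exact absurd (norm_le_of_normSqLast_le hρ (by linarith)) (not_le.2 h)

theorem hasCompactSupport_of_norm {V W : Type} [NormedAddCommGroup V] [ProperSpace V] [Zero W]
    {f : V → W} {ρ : ℝ} (h : ∀ z, ρ < ‖z‖ → f z = 0) : HasCompactSupport f :=
  HasCompactSupport.intro (isCompact_closedBall (0 : V) ρ) fun z hz => h z (by simpa using hz)

theorem integral_radialKernel_pos {ρ : ℝ} (hρ : 0 < ρ)
    {μ : Measure (EuclideanSpace ℝ ι × ℝ)} [μ.IsAddHaarMeasure] :
    0 < ∫ z, radialKernel ρ z ∂μ := by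
  refine (contDiff_radialKernel ρ).continuous.integral_pos_of_hasCompactSupport_nonneg_nonzero
    (hasCompactSupport_of_norm fun z hz => radialKernel_eq_zero hρ.le hz)
    (fun z => Real.smoothTransition.nonneg _) (x := 0) ?_
  refine (Real.smoothTransition.pos_of_pos ?_).ne'
  simp only [normSqLast, Prod.fst_zero, Prod.snd_zero, norm_zero]
  simpa using by positivity

/-- The potential `H` with `∇ H (y) = -2 radialKernel ρ y • y`. -/
def radialPotential (ρ : ℝ) (z : EuclideanSpace ℝ ι × ℝ) : ℝ :=
  transitionPrimitive (ρ ^ 2) (normSqLast z)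

theorem contDiff_radialPotential (ρ : ℝ) : ContDiff ℝ ∞ (radialPotential (ι := ι) ρ) :=
  (contDiff_transitionPrimitive _).comp contDiff_normSqLast

theorem radialPotential_eq_zero {ρ : ℝ} (hρ : 0 ≤ ρ) {z : EuclideanSpace ℝ ι × ℝ} (h : ρ < ‖z‖) :
    radialPotential ρ z = 0 := by
  refine transitionPrimitive_eq_zero ?_
  by_contra! h'
  exact absurd (norm_le_of_normSqLast_le hρ h'.le) (not_le.2 h)

theorem tsupport_radialPotential_subset {ρ : ℝ} (hρ : 0 ≤ ρ) :
    tsupport (radialPotential (ι := ι) ρ) ⊆ Metric.closedBall 0 ρ := by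
  refine closure_minimal (fun z hz => ?_) Metric.isClosed_closedBall
  by_contra h
  exact hz (radialPotential_eq_zero hρ (by simpa using h))

theorem fderiv_radialPotential (ρ : ℝ) (z v : EuclideanSpace ℝ ι × ℝ) :
    fderiv ℝ (radialPotential ρ) z v =
      -2 * radialKernel ρ z * (inner ℝ z.1 v.1 + z.2 * v.2) := by
  have := (hasDerivAt_transitionPrimitive (ρ ^ 2) (normSqLast z)).hasFDerivAt.comp z
    (hasFDerivAt_normSqLast z)
  rw [show radialPotential ρ = transitionPrimitive (ρ ^ 2) ∘ normSqLast (ι := ι) from rfl,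
    this.fderiv]
  simp [radialKernel]
  ring

theorem map_eq_sum_single {F : Type} [NormedAddCommGroup F] [NormedSpace ℝ F] [DecidableEq ι]
    (L : EuclideanSpace ℝ ι × ℝ →L[ℝ] F) (z : EuclideanSpace ℝ ι × ℝ) :
    L z = ∑ i, z.1 i • L (EuclideanSpace.single i 1, 0) + z.2 • L (0, 1) := by
  have h : z = ∑ i, z.1 i • ((EuclideanSpace.single i 1, 0) : EuclideanSpace ℝ ι × ℝ) +
      z.2 • ((0, 1) : EuclideanSpace ℝ ι × ℝ) := by
    refine Prod.ext ?_ ?_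
    · ext j
      simp [Prod.fst_sum, Finset.sum_apply, Pi.single_apply]
    · simp [Prod.snd_sum]
  conv_lhs => rw [h]
  simp only [map_add, map_sum, map_smul]

/-- The integrand is odd. -/
theorem integral_radialKernel_smul_eq_zero_of_linear {F : Type}
    [NormedAddCommGroup F] [NormedSpace ℝ F] {μ : Measure (EuclideanSpace ℝ ι × ℝ)}
    [μ.IsAddHaarMeasure] (ρ : ℝ) (L : EuclideanSpace ℝ ι × ℝ →L[ℝ] F) :
    ∫ y, radialKernel ρ y • L y ∂μ = 0 := by
  have h := integral_neg_eq_self (fun y => radialKernel ρ y • L y) μ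
  have h' : ∀ y : EuclideanSpace ℝ ι × ℝ, radialKernel ρ (-y) • L (-y) =
      -(radialKernel ρ y • L y) := fun y => by
    simp [radialKernel, normSqLast]
  simp_rw [h', integral_neg] at h
  have h2 : (2 : ℝ) • ∫ y, radialKernel ρ y • L y ∂μ = 0 := by
    rw [two_smul]
    nth_rewrite 1 [← h]
    exact neg_add_cancel _
  exact (smul_eq_zero.1 h2).resolve_left two_ne_zero

end RadialKernel

/-! ### Mean value property and Weyl's lemma -/

section Weyl

variable {ι F : Type} [Fintype ι] [DecidableEq ι] [NormedAddCommGroup F] [NormedSpace ℝ F]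
  [CompleteSpace F]

/-- The infinitesimal mean value property of solutions of a generalized Cauchy-Riemann system. -/
theorem integral_radialKernel_smul_fderiv_eq_zero {μ : Measure (EuclideanSpace ℝ ι × ℝ)}
    [μ.IsAddHaarMeasure] {a b : ι → F →L[ℝ] F}
    (hab : ∀ i j u, a i (b j u) + a j (b i u) = if i = j then (2 : ℝ) • u else 0)
    {ρ : ℝ} (hρ : 0 ≤ ρ) {v₁ v₂ : EuclideanSpace ℝ ι × ℝ → F} (hv₁ : ContDiff ℝ 1 v₁)
    (hv₂ : ContDiff ℝ 1 v₂)
    (h1 : ∀ y, ‖y‖ ≤ ρ → ∑ i, b i (fderiv ℝ v₁ y (EuclideanSpace.single i 1, 0)) =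
      fderiv ℝ v₂ y (0, 1))
    (h2 : ∀ y, ‖y‖ ≤ ρ → ∑ i, a i (fderiv ℝ v₂ y (EuclideanSpace.single i 1, 0)) =
      -fderiv ℝ v₁ y (0, 1)) :
    ∫ y, radialKernel ρ y • fderiv ℝ v₁ y y ∂μ = 0 := by
  have hH := contDiff_radialPotential (ι := ι) ρ
  have hHc : HasCompactSupport (radialPotential (ι := ι) ρ) :=
    hasCompactSupport_of_norm fun z hz => radialPotential_eq_zero hρ hz
  have hsupp : ∀ y ∈ tsupport (radialPotential (ι := ι) ρ), ‖y‖ ≤ ρ := fun y hy => by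
    simpa using tsupport_radialPotential_subset hρ hy
  have key := sum_integral_fderiv_smul_fderiv_eq_zero (μ := μ) hab hH hHc hv₁ hv₂
    (fun y hy => h1 y (hsupp y hy)) (fun y hy => h2 y (hsupp y hy))
  have hint := fun c d => integrable_fderiv_smul_fderiv (μ := μ) hH hHc hv₁ c d
  rw [← integral_finsetSum _ fun i _ => hint _ _,
    ← integral_add (integrable_finsetSum _ fun i _ => hint _ _) (hint _ _)] at key
  -- The gradient of the potential at y is -2 times the kernel times y, so the weak equation tested
  -- on it is the integral of the derivative of v₁ in the direction y.
  have : ∀ y : EuclideanSpace ℝ ι × ℝ, ∑ i, fderiv ℝ (radialPotential ρ) y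
      (EuclideanSpace.single i 1, 0) • fderiv ℝ v₁ y (EuclideanSpace.single i 1, 0) +
      fderiv ℝ (radialPotential ρ) y (0, 1) • fderiv ℝ v₁ y (0, 1) =
      (-2 : ℝ) • (radialKernel ρ y • fderiv ℝ v₁ y y) := fun y => by
    rw [map_eq_sum_single (fderiv ℝ v₁ y) y, smul_add, smul_add, Finset.smul_sum,
      Finset.smul_sum]
    simp only [fderiv_radialPotential, smul_smul]
    simp [EuclideanSpace.inner_single_right, mul_assoc]
  simp_rw [this] at key
  rw [integral_smul] at key
  exact (smul_eq_zero.1 key).resolve_left (by norm_num)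

/-- The mean value property of solutions of a generalized Cauchy-Riemann system. -/
theorem integral_radialKernel_smul_sub {μ : Measure (EuclideanSpace ℝ ι × ℝ)}
    [μ.IsAddHaarMeasure] {a b : ι → F →L[ℝ] F}
    (hab : ∀ i j u, a i (b j u) + a j (b i u) = if i = j then (2 : ℝ) • u else 0)
    {ρ : ℝ} (hρ : 0 ≤ ρ) {u₁ u₂ : EuclideanSpace ℝ ι × ℝ → F} (hu₁ : ContDiff ℝ 1 u₁)
    (hu₂ : ContDiff ℝ 1 u₂) (hc : HasCompactSupport u₁) {x : EuclideanSpace ℝ ι × ℝ}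
    (h1 : ∀ y, ‖y - x‖ ≤ ρ → ∑ i, b i (fderiv ℝ u₁ y (EuclideanSpace.single i 1, 0)) =
      fderiv ℝ u₂ y (0, 1))
    (h2 : ∀ y, ‖y - x‖ ≤ ρ → ∑ i, a i (fderiv ℝ u₂ y (EuclideanSpace.single i 1, 0)) =
      -fderiv ℝ u₁ y (0, 1)) :
    ∫ y, radialKernel ρ y • u₁ (x - y) ∂μ = (∫ y, radialKernel ρ y ∂μ) • u₁ x := by
  have hkc := (contDiff_radialKernel (ι := ι) ρ).continuous
  have hks : HasCompactSupport (radialKernel (ι := ι) ρ) :=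
    hasCompactSupport_of_norm fun z hz => radialKernel_eq_zero hρ hz
  have hder : ∀ {u : EuclideanSpace ℝ ι × ℝ → F}, ContDiff ℝ 1 u → ∀ (s : ℝ) y,
      HasFDerivAt (fun y => u (x - s • y)) (-s • fderiv ℝ u (x - s • y)) y := by
    intro u hu s y
    have h := (hu.differentiable (by simp)).differentiableAt.hasFDerivAt (x := x - s • y)
    refine (h.comp y ((hasFDerivAt_id y).const_smul s |>.const_sub x)).congr_fderiv ?_
    ext v <;> simp
  have hds : ∀ (s : ℝ) y, HasDerivAt (fun s : ℝ => u₁ (x - s • y))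
      (-fderiv ℝ u₁ (x - s • y) y) s := by
    intro s y
    have h := (hu₁.differentiable (by simp)).differentiableAt.hasFDerivAt (x := x - s • y)
    have h' := h.comp_hasDerivAt s (((hasDerivAt_id s).smul_const y).const_sub x)
    simpa [Function.comp_def] using h'
  obtain ⟨C, hC⟩ := (hc.fderiv (𝕜 := ℝ)).exists_bound_of_continuous
    (hu₁.continuous_fderiv (by simp))
  have hcont : ∀ s : ℝ, Continuous fun y => radialKernel ρ y • u₁ (x - s • y) := fun s =>
    hkc.smul (hu₁.continuous.comp (by fun_prop))
  have hcont' : ∀ s : ℝ, Continuous fun y => radialKernel ρ y • -fderiv ℝ u₁ (x - s • y) y :=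
    fun s => hkc.smul (((hu₁.continuous_fderiv (by simp)).comp (by fun_prop)).clm_apply
      continuous_id).neg
  -- The mean over the kernel dilated by s interpolates between u₁(x) times the mass, at s = 0, and
  -- the convolution, at s = 1. It is shown to be constant in s.
  have hm : ∀ s : ℝ, HasDerivAt (fun s : ℝ => ∫ y, radialKernel ρ y • u₁ (x - s • y) ∂μ)
      (∫ y, radialKernel ρ y • -fderiv ℝ u₁ (x - s • y) y ∂μ) s := by
    intro s
    refine (hasDerivAt_integral_of_dominated_loc_of_deriv_le
      (bound := fun y => ‖radialKernel ρ y‖ * (C * ‖y‖)) univ_mem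
      (Eventually.of_forall fun s => (hcont s).aestronglyMeasurable)
      ((hcont s).integrable_of_hasCompactSupport hks.smul_right)
      (hcont' s).aestronglyMeasurable
      (Eventually.of_forall fun y s _ => ?_) ?_
      (Eventually.of_forall fun y s _ => (hds s y).const_smul _)).2
    · rw [norm_smul, norm_neg]
      gcongr
      exact (ContinuousLinearMap.le_opNorm _ _).trans (by gcongr; exact hC _)
    · exact (hkc.norm.mul (by fun_prop)).integrable_of_hasCompactSupport hks.norm.mul_right
  have hm0 : ∀ s ∈ Ico (0 : ℝ) 1,
      ∫ y, radialKernel ρ y • -fderiv ℝ u₁ (x - s • y) y ∂μ = 0 := by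
    intro s hs
    -- For s ≠ 0, the maps y ↦ uᵢ(x - s y) solve the same homogeneous system, and the factor -s from
    -- the chain rule can be divided out. At s = 0 that division fails, but the integrand is linear
    -- in y up to the kernel.
    by_cases h0 : s = 0
    · subst h0
      simpa [integral_neg] using integral_radialKernel_smul_eq_zero_of_linear (μ := μ) ρ
        (fderiv ℝ u₁ x)
    · have hnorm : ∀ y : EuclideanSpace ℝ ι × ℝ, ‖y‖ ≤ ρ → ‖x - s • y - x‖ ≤ ρ := fun y hy => by
        rw [sub_sub_cancel_left, norm_neg, norm_smul, Real.norm_of_nonneg hs.1]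
        nlinarith [hs.1, hs.2, norm_nonneg y]
      have hv := fun {u : EuclideanSpace ℝ ι × ℝ → F} (hu : ContDiff ℝ 1 u) =>
        hu.comp (contDiff_const.sub (contDiff_id.const_smul s) :
          ContDiff ℝ 1 fun y : EuclideanSpace ℝ ι × ℝ => x - s • y)
      have := integral_radialKernel_smul_fderiv_eq_zero (μ := μ) hab hρ (hv hu₁) (hv hu₂)
        (fun y hy => ?_) (fun y hy => ?_)
      · simp only [Function.comp_def, (hder hu₁ s _).fderiv] at this
        simp only [neg_smul, _root_.smul_apply, smul_neg, integral_neg,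
          smul_comm _ s, integral_smul, neg_eq_zero] at this ⊢
        exact (smul_eq_zero.1 this).resolve_left h0
      · simp only [Function.comp_def, (hder hu₁ s _).fderiv, (hder hu₂ s _).fderiv,
          _root_.smul_apply, map_smul, ← Finset.smul_sum, h1 _ (hnorm y hy)]
      · simp only [Function.comp_def, (hder hu₁ s _).fderiv, (hder hu₂ s _).fderiv,
          _root_.smul_apply, map_smul, ← Finset.smul_sum, h2 _ (hnorm y hy), smul_neg]
  have := constant_of_has_deriv_right_zero
    (fun s _ => (hm s).continuousAt.continuousWithinAt)
    (fun s hs => ((hm s).congr_deriv (hm0 s hs)).hasDerivWithinAt) 1 ⟨zero_le_one, le_rfl⟩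
  simpa [integral_smul_const] using this

/-- **Weyl's lemma** for generalized Cauchy-Riemann systems: the first component of a solution of
class `C¹` is smooth. -/
theorem contDiffOn_of_cauchyRiemann {a b : ι → F →L[ℝ] F}
    (hab : ∀ i j u, a i (b j u) + a j (b i u) = if i = j then (2 : ℝ) • u else 0)
    {D : Set (EuclideanSpace ℝ ι × ℝ)} (hD : IsOpen D) {u₁ u₂ : EuclideanSpace ℝ ι × ℝ → F}
    (hu₁ : ContDiffOn ℝ 1 u₁ D) (hu₂ : ContDiffOn ℝ 1 u₂ D)
    (h1 : ∀ y ∈ D, ∑ i, b i (fderiv ℝ u₁ y (EuclideanSpace.single i 1, 0)) =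
      fderiv ℝ u₂ y (0, 1))
    (h2 : ∀ y ∈ D, ∑ i, a i (fderiv ℝ u₂ y (EuclideanSpace.single i 1, 0)) =
      -fderiv ℝ u₁ y (0, 1)) :
    ContDiffOn ℝ ∞ u₁ D := by
  intro x₀ hx₀
  let μ : Measure (EuclideanSpace ℝ ι × ℝ) := Measure.addHaar
  obtain ⟨δ₁, hδ₁, hs₁, w₁, hw₁, hc₁, he₁⟩ :=
    ContDiffOn.exists_global_extension (n := 1) hD hu₁ hx₀
  obtain ⟨δ₂, hδ₂, hs₂, w₂, hw₂, hc₂, he₂⟩ :=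
    ContDiffOn.exists_global_extension (n := 1) hD hu₂ hx₀
  set δ := min δ₁ δ₂
  have hδ : 0 < δ := lt_min hδ₁ hδ₂
  have hb₁ : Metric.ball x₀ δ ⊆ Metric.ball x₀ δ₁ := Metric.ball_subset_ball (min_le_left _ _)
  have hb₂ : Metric.ball x₀ δ ⊆ Metric.ball x₀ δ₂ := Metric.ball_subset_ball (min_le_right _ _)
  have hf₁ : ∀ y ∈ Metric.ball x₀ δ, fderiv ℝ w₁ y = fderiv ℝ u₁ y := fun y hy =>
    (he₁.eventuallyEq_of_mem (Metric.isOpen_ball.mem_nhds (hb₁ hy))).fderiv_eq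
  have hf₂ : ∀ y ∈ Metric.ball x₀ δ, fderiv ℝ w₂ y = fderiv ℝ u₂ y := fun y hy =>
    (he₂.eventuallyEq_of_mem (Metric.isOpen_ball.mem_nhds (hb₂ hy))).fderiv_eq
  set K : ℝ := ∫ y, radialKernel (δ / 2) y ∂μ
  have hK : 0 < K := integral_radialKernel_pos (half_pos hδ)
  -- All the smoothness comes from the kernel; w₁ only has to be locally integrable. The radius δ/2
  -- keeps the balls around points within δ/2 of x₀ inside the region where the extensions agree
  -- with u₁ and u₂.
  have hconv : ContDiff ℝ ∞ fun x => K⁻¹ • ∫ y, radialKernel (δ / 2) y • w₁ (x - y) ∂μ :=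
    (HasCompactSupport.contDiff_convolution_left (μ := μ) (n := ⊤) (ContinuousLinearMap.lsmul ℝ ℝ)
      (hasCompactSupport_of_norm fun z hz => radialKernel_eq_zero (half_pos hδ).le hz)
      (contDiff_radialKernel (δ / 2)) hw₁.continuous.locallyIntegrable).const_smul _
  refine (hconv.contDiffAt.congr_of_eventuallyEq ?_).contDiffWithinAt
  filter_upwards [Metric.ball_mem_nhds x₀ (half_pos hδ)] with x hx
  have hmem : ∀ y, ‖y - x‖ ≤ δ / 2 → y ∈ Metric.ball x₀ δ := fun y hy => by
    have h := dist_triangle y x x₀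
    rw [Metric.mem_ball] at hx ⊢
    rw [dist_eq_norm y x] at h
    linarith
  rw [integral_radialKernel_smul_sub (μ := μ) hab (half_pos hδ).le hw₁ hw₂ hc₁
    (fun y hy => ?_) (fun y hy => ?_), inv_smul_smul₀ hK.ne', he₁]
  · exact hb₁ (Metric.ball_subset_ball (by linarith) hx)
  · rw [hf₁ y (hmem y hy), hf₂ y (hmem y hy)]
    exact h1 y (hs₁ (hb₁ (hmem y hy)))
  · rw [hf₁ y (hmem y hy), hf₂ y (hmem y hy)]
    exact h2 y (hs₁ (hb₁ (hmem y hy)))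

end Weyl

/-! ### Calculus of directional derivatives -/

section DirectionalDerivative

variable {V F : Type} [NormedAddCommGroup V] [NormedSpace ℝ V] [NormedAddCommGroup F]
  [NormedSpace ℝ F] {U : Set V}

/-- The derivative in the direction `v`, as an operator on functions. -/
def dirDeriv (v : V) (f : V → F) (x : V) : F := fderiv ℝ f x v

theorem dirDeriv_congr (hU : IsOpen U) {f g : V → F} (h : EqOn f g U) (v : V) :
    EqOn (dirDeriv v f) (dirDeriv v g) U := fun x hx => by
  unfold dirDeriv
  rw [(h.eventuallyEq_of_mem (hU.mem_nhds hx)).fderiv_eq]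

theorem contDiffOn_dirDeriv (hU : IsOpen U) {f : V → F} (hf : ContDiffOn ℝ ∞ f U) (v : V) :
    ContDiffOn ℝ ∞ (dirDeriv v f) U :=
  (hf.fderiv_of_isOpen hU (by simp)).clm_apply contDiffOn_const

theorem ContDiffOn.differentiableAt_of_isOpen (hU : IsOpen U) {f : V → F}
    (hf : ContDiffOn ℝ ∞ f U) {x : V} (hx : x ∈ U) : DifferentiableAt ℝ f x :=
  (hf.contDiffAt (hU.mem_nhds hx)).differentiableAt (by simp)

theorem dirDeriv_dirDeriv (hU : IsOpen U) {f : V → F} (hf : ContDiffOn ℝ ∞ f U) (v w : V) {x : V}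
    (hx : x ∈ U) : dirDeriv v (dirDeriv w f) x = fderiv ℝ (fderiv ℝ f) x v w := by
  have h : DifferentiableAt ℝ (fderiv ℝ f) x :=
    ContDiffOn.differentiableAt_of_isOpen hU (hf.fderiv_of_isOpen hU (by simp)) hx
  unfold dirDeriv
  rw [fderiv_clm_apply h (by fun_prop)]
  simp

theorem dirDeriv_comm (hU : IsOpen U) {f : V → F} (hf : ContDiffOn ℝ ∞ f U) (v w : V) {x : V}
    (hx : x ∈ U) : dirDeriv v (dirDeriv w f) x = dirDeriv w (dirDeriv v f) x := by
  rw [dirDeriv_dirDeriv hU hf v w hx, dirDeriv_dirDeriv hU hf w v hx]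
  exact ((hf.contDiffAt (hU.mem_nhds hx)).isSymmSndFDerivAt (by simpa using ENat.LEInfty.out)).eq
    v w

theorem contDiffOn_clm (L : F →L[ℝ] F) {f : V → F} (hf : ContDiffOn ℝ ∞ f U) :
    ContDiffOn ℝ ∞ (fun x => L (f x)) U :=
  L.contDiff.comp_contDiffOn hf

theorem dirDeriv_clm (L : F →L[ℝ] F) {f : V → F} {x : V} (hf : DifferentiableAt ℝ f x) (v : V) :
    dirDeriv v (fun x => L (f x)) x = L (dirDeriv v f x) := by
  unfold dirDeriv
  exact congrArg (· v) (L.hasFDerivAt.comp x hf.hasFDerivAt).fderiv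

theorem dirDeriv_sum {ι : Type} [Fintype ι] {f : ι → V → F} {x : V}
    (hf : ∀ i, DifferentiableAt ℝ (f i) x) (v : V) :
    dirDeriv v (fun x => ∑ i, f i x) x = ∑ i, dirDeriv v (f i) x := by
  unfold dirDeriv
  rw [fderiv_fun_sum fun i _ => hf i, _root_.sum_apply]

theorem dirDeriv_add {f g : V → F} {x : V} (hf : DifferentiableAt ℝ f x)
    (hg : DifferentiableAt ℝ g x) (v : V) :
    dirDeriv v (fun x => f x + g x) x = dirDeriv v f x + dirDeriv v g x := by
  unfold dirDeriv
  rw [fderiv_fun_add hf hg]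
  rfl

theorem dirDeriv_neg (f : V → F) (x v : V) :
    dirDeriv v (fun x => -f x) x = -dirDeriv v f x := by
  unfold dirDeriv
  rw [fderiv_fun_neg]
  rfl

theorem dirDeriv_const_smul (c : ℝ) {f : V → F} {x : V} (hf : DifferentiableAt ℝ f x) (v : V) :
    dirDeriv v (fun x => c • f x) x = c • dirDeriv v f x := by
  unfold dirDeriv
  rw [fderiv_fun_const_smul hf]
  rfl

theorem dirDeriv_smul {c : V → ℝ} {f : V → F} {x : V} (hc : DifferentiableAt ℝ c x)
    (hf : DifferentiableAt ℝ f x) (v : V) :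
    dirDeriv v (fun x => c x • f x) x = dirDeriv v c x • f x + c x • dirDeriv v f x := by
  unfold dirDeriv
  rw [fderiv_fun_smul hc hf]
  simp [add_comm]

end DirectionalDerivative

/-! ### Iterated Laplacians and constant coefficient operators -/

section LaplacianEuclidean

variable {κ F : Type} [Fintype κ] [NormedAddCommGroup F] [NormedSpace ℝ F]
  {U : Set (EuclideanSpace ℝ κ)}

theorem laplacian_congr_of_isOpen (hU : IsOpen U) {f g : EuclideanSpace ℝ κ → F}
    (h : EqOn f g U) : EqOn (laplacian f) (laplacian g) U := fun _ hx =>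
  (InnerProductSpace.laplacian_congr_nhds (h.eventuallyEq_of_mem (hU.mem_nhds hx))).self_of_nhds

theorem iterate_laplacian_congr_of_isOpen (hU : IsOpen U) (n : ℕ) :
    ∀ {f g : EuclideanSpace ℝ κ → F}, EqOn f g U →
      EqOn (laplacian^[n] f) (laplacian^[n] g) U := by
  induction n with
  | zero => exact fun h => h
  | succ n ih => exact fun h => ih (laplacian_congr_of_isOpen hU h)

variable [DecidableEq κ]

theorem laplacian_eq_sum_dirDeriv (hU : IsOpen U) {f : EuclideanSpace ℝ κ → F}
    (hf : ContDiffOn ℝ ∞ f U) {x : EuclideanSpace ℝ κ} (hx : x ∈ U) :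
    laplacian f x = ∑ i, dirDeriv (EuclideanSpace.single i 1)
      (dirDeriv (EuclideanSpace.single i 1) f) x := by
  rw [InnerProductSpace.laplacian_eq_iteratedFDeriv_orthonormalBasis f
    (EuclideanSpace.basisFun κ ℝ)]
  refine Finset.sum_congr rfl fun i _ => ?_
  rw [dirDeriv_dirDeriv hU hf _ _ hx, iteratedFDeriv_two_apply]
  simp

theorem contDiffOn_laplacian (hU : IsOpen U) {f : EuclideanSpace ℝ κ → F}
    (hf : ContDiffOn ℝ ∞ f U) : ContDiffOn ℝ ∞ (laplacian f) U :=
  (ContDiffOn.sum fun _ _ => contDiffOn_dirDeriv hU (contDiffOn_dirDeriv hU hf _) _).congr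
    fun _ hx => laplacian_eq_sum_dirDeriv hU hf hx

theorem contDiffOn_iterate_laplacian (hU : IsOpen U) (n : ℕ) :
    ∀ {f : EuclideanSpace ℝ κ → F}, ContDiffOn ℝ ∞ f U →
      ContDiffOn ℝ ∞ (laplacian^[n] f) U := by
  induction n with
  | zero => exact fun h => h
  | succ n ih => exact fun h => ih (contDiffOn_laplacian hU h)

theorem dirDeriv_laplacian (hU : IsOpen U) {f : EuclideanSpace ℝ κ → F}
    (hf : ContDiffOn ℝ ∞ f U) (v : EuclideanSpace ℝ κ) :
    EqOn (dirDeriv v (laplacian f)) (laplacian (dirDeriv v f)) U := fun x hx => by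
  have hd := fun v => contDiffOn_dirDeriv hU hf v
  have hdd := fun v w => contDiffOn_dirDeriv hU (hd v) w
  rw [dirDeriv_congr hU (fun y hy => laplacian_eq_sum_dirDeriv hU hf hy) v hx,
    dirDeriv_sum fun i => (hdd _ _).differentiableAt_of_isOpen hU hx,
    laplacian_eq_sum_dirDeriv hU (hd v) hx]
  refine Finset.sum_congr rfl fun i _ => ?_
  rw [dirDeriv_comm hU (hd _) _ _ hx]
  exact dirDeriv_congr hU (fun y hy => dirDeriv_comm hU hf _ _ hy) _ hx

/-- A constant coefficient first order operator commutes with the Laplacian. -/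
theorem sum_dirDeriv_laplacian (hU : IsOpen U) {c : κ → F →L[ℝ] F} {f : EuclideanSpace ℝ κ → F}
    (hf : ContDiffOn ℝ ∞ f U) :
    EqOn (fun x => ∑ i, c i (dirDeriv (EuclideanSpace.single i 1) (laplacian f) x))
      (laplacian fun x => ∑ i, c i (dirDeriv (EuclideanSpace.single i 1) f x)) U := fun x hx => by
  have hd := fun v => contDiffOn_dirDeriv hU hf v
  have hc : ∀ i, ContDiffOn ℝ ∞
      (fun x => c i (dirDeriv (EuclideanSpace.single i 1) f x)) U := fun i =>
    contDiffOn_clm (c i) (hd _)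
  have hdd := fun v w => contDiffOn_dirDeriv hU (hd v) w
  rw [laplacian_eq_sum_dirDeriv hU (ContDiffOn.sum fun i _ => hc i) hx]
  have h1 : ∀ v, EqOn (dirDeriv v fun x => ∑ i, c i (dirDeriv (EuclideanSpace.single i 1) f x))
      (fun x => ∑ i, c i (dirDeriv v (dirDeriv (EuclideanSpace.single i 1) f) x)) U := by
    intro v y hy
    rw [dirDeriv_sum fun i => (hc i).differentiableAt_of_isOpen hU hy]
    exact Finset.sum_congr rfl fun i _ =>
      dirDeriv_clm (c i) ((hd _).differentiableAt_of_isOpen hU hy) v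
  have h2 : ∀ v, dirDeriv v
      (dirDeriv v fun x => ∑ i, c i (dirDeriv (EuclideanSpace.single i 1) f x))
      x = ∑ i, c i (dirDeriv v (dirDeriv v (dirDeriv (EuclideanSpace.single i 1) f)) x) := by
    intro v
    rw [dirDeriv_congr hU (h1 v) v hx, dirDeriv_sum fun i => ContDiffOn.differentiableAt_of_isOpen
      hU (contDiffOn_clm (c i) (hdd _ v)) hx]
    exact Finset.sum_congr rfl fun i _ =>
      dirDeriv_clm (c i) ((hdd _ v).differentiableAt_of_isOpen hU hx) v
  simp_rw [h2]
  rw [Finset.sum_comm]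
  refine Finset.sum_congr rfl fun i _ => ?_
  rw [← map_sum, dirDeriv_laplacian hU hf _ hx, laplacian_eq_sum_dirDeriv hU (hd _) hx]

theorem sum_dirDeriv_iterate_laplacian (hU : IsOpen U) {c : κ → F →L[ℝ] F} (n : ℕ) :
    ∀ {f : EuclideanSpace ℝ κ → F}, ContDiffOn ℝ ∞ f U →
      EqOn (fun x => ∑ i, c i (dirDeriv (EuclideanSpace.single i 1) (laplacian^[n] f) x))
        (laplacian^[n] fun x => ∑ i, c i (dirDeriv (EuclideanSpace.single i 1) f x)) U := by
  induction n with
  | zero => exact fun _ _ _ => rfl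
  | succ n ih =>
    intro f hf x hx
    exact (ih (contDiffOn_laplacian hU hf) hx).trans
      (iterate_laplacian_congr_of_isOpen hU n (sum_dirDeriv_laplacian hU hf) hx)

/-- Factorization of the Laplacian by first order operators. -/
theorem laplacian_eq_sum_sum_dirDeriv (hU : IsOpen U) {a b : κ → F →L[ℝ] F}
    (hab : ∀ i j u, a i (b j u) + a j (b i u) = if i = j then (2 : ℝ) • u else 0)
    {f : EuclideanSpace ℝ κ → F} (hf : ContDiffOn ℝ ∞ f U) {x : EuclideanSpace ℝ κ} (hx : x ∈ U) :
    laplacian f x = ∑ i, a i (dirDeriv (EuclideanSpace.single i 1)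
      (fun y => ∑ j, b j (dirDeriv (EuclideanSpace.single j 1) f y)) x) := by
  have hd := fun v => contDiffOn_dirDeriv hU hf v
  rw [laplacian_eq_sum_dirDeriv hU hf hx, ← sum_sum_apply_of_symm hab fun i j =>
    dirDeriv_comm hU hf (EuclideanSpace.single i 1) (EuclideanSpace.single j 1) hx]
  refine Finset.sum_congr rfl fun i _ => ?_
  rw [dirDeriv_sum fun j => ContDiffOn.differentiableAt_of_isOpen hU
    (contDiffOn_clm (b j) (hd _)) hx, map_sum]
  refine Finset.sum_congr rfl fun j _ => ?_
  rw [dirDeriv_clm (b j) ((hd _).differentiableAt_of_isOpen hU hx)]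

theorem iterate_laplacian_const_smul (hU : IsOpen U) (c : ℝ) (n : ℕ) :
    ∀ {f : EuclideanSpace ℝ κ → F}, ContDiffOn ℝ ∞ f U →
      EqOn (laplacian^[n] fun x => c • f x) (fun x => c • (laplacian^[n] f) x) U := by
  induction n with
  | zero => exact fun _ _ _ => rfl
  | succ n ih =>
    intro f hf x hx
    refine (iterate_laplacian_congr_of_isOpen hU n (fun y hy => ?_) hx).trans
      (ih (contDiffOn_laplacian hU hf) hx)
    exact InnerProductSpace.laplacian_smul c
      ((hf.contDiffAt (hU.mem_nhds hy)).of_le ENat.LEInfty.out)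

end LaplacianEuclidean

/-! ### Clifford algebra identities -/

namespace RealClifford

/-- Left multiplication, as a continuous linear map. -/
def mulLeftCLM {n : ℕ} (a : RealClifford n) : RealClifford n →L[ℝ] RealClifford n :=
  LinearMap.toContinuousLinearMap (LinearMap.mulLeft ℝ a)

@[simp]
theorem mulLeftCLM_apply {n : ℕ} (a u : RealClifford n) : mulLeftCLM a u = a * u := rfl

theorem star_gen {n : ℕ} (i : Fin n) : star (gen i : RealClifford n) = -gen i :=
  CliffordAlgebra.star_ι _

instance instCompleteSpace (n : ℕ) : CompleteSpace (RealClifford n) :=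
  FiniteDimensional.complete ℝ _

end RealClifford

namespace PartialSlice

variable {p q : ℕ}

open RealClifford

section Units

theorem unit_inl_zero : unit p q (.inl 0) = 1 := rfl

theorem unit_inl_succ (k : Fin p) : unit p q (.inl k.succ) = gen (Fin.castAdd q k) := rfl

theorem unit_inr (j : Fin q) : unit p q (.inr j) = gen (Fin.natAdd p j) := rfl

theorem gen_mul_gen_comm_of_ne {n : ℕ} {i j : Fin n} (h : i ≠ j) :
    (gen i * gen j : RealClifford n) = -(gen j * gen i) := by
  have := gen_mul_gen_add_swap i j
  rw [if_neg h] at this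
  exact eq_neg_of_add_eq_zero_left this

theorem two_eq_smul {n : ℕ} (u : RealClifford n) : (2 : RealClifford n) * u = (2 : ℝ) • u := by
  rw [two_mul, two_smul]

/-- Conjugation lets e₀ = 1, of square 1, obey the same relation as the generators, of square -1.
This is the relation that factors the Laplacian. -/
theorem star_unit_mul_unit_add_swap (α β : Fin (p + 1) ⊕ Fin q) :
    star (unit p q α) * unit p q β + star (unit p q β) * unit p q α =
      if α = β then 2 else 0 := by
  have hne : ∀ (i : Fin p) (j : Fin q), Fin.castAdd q i ≠ Fin.natAdd p j := fun i j h => by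
    have := congrArg Fin.val h
    simp at this
    omega
  have hgen : ∀ k l : Fin (p + q), star (gen k : RealClifford (p + q)) * gen l +
      star (gen l) * gen k = if k = l then 2 else 0 := fun k l => by
    rw [star_gen, star_gen, neg_mul, neg_mul, ← neg_add, gen_mul_gen_add_swap]
    split_ifs <;> simp
  rcases α with i | i <;> rcases β with j | j
  · refine Fin.cases ?_ (fun i => ?_) i <;> refine Fin.cases ?_ (fun j => ?_) j
    · simp [unit_inl_zero, one_add_one_eq_two]
    · simp [unit_inl_zero, unit_inl_succ, star_gen, (Fin.succ_ne_zero j).symm]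
    · simp [unit_inl_zero, unit_inl_succ, star_gen]
    · simp [unit_inl_succ, hgen]
  · refine Fin.cases ?_ (fun i => ?_) i
    · simp [unit_inl_zero, unit_inr, star_gen]
    · simp [unit_inl_succ, unit_inr, hgen, hne]
  · refine Fin.cases ?_ (fun j => ?_) j
    · simp [unit_inl_zero, unit_inr, star_gen]
    · simp [unit_inl_succ, unit_inr, hgen, (hne _ _).symm]
  · simp [unit_inr, hgen]

theorem unit_mul_star_unit_add_swap (α β : Fin (p + 1) ⊕ Fin q) :
    unit p q α * star (unit p q β) + unit p q β * star (unit p q α) =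
      if α = β then 2 else 0 := by
  have hne : ∀ (i : Fin p) (j : Fin q), Fin.castAdd q i ≠ Fin.natAdd p j := fun i j h => by
    have := congrArg Fin.val h
    simp at this
    omega
  have hgen : ∀ k l : Fin (p + q), (gen k : RealClifford (p + q)) * star (gen l) +
      gen l * star (gen k) = if k = l then 2 else 0 := fun k l => by
    rw [star_gen, star_gen, mul_neg, mul_neg, ← neg_add, gen_mul_gen_add_swap]
    split_ifs <;> simp
  rcases α with i | i <;> rcases β with j | j
  · refine Fin.cases ?_ (fun i => ?_) i <;> refine Fin.cases ?_ (fun j => ?_) j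
    · simp [unit_inl_zero, one_add_one_eq_two]
    · simp [unit_inl_zero, unit_inl_succ, star_gen, (Fin.succ_ne_zero j).symm]
    · simp [unit_inl_zero, unit_inl_succ, star_gen]
    · simp [unit_inl_succ, hgen]
  · refine Fin.cases ?_ (fun i => ?_) i
    · simp [unit_inl_zero, unit_inr, star_gen]
    · simp [unit_inl_succ, unit_inr, hgen, hne]
  · refine Fin.cases ?_ (fun j => ?_) j
    · simp [unit_inl_zero, unit_inr, star_gen]
    · simp [unit_inl_succ, unit_inr, hgen, (hne _ _).symm]
  · simp [unit_inr, hgen]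

/-- Each e_{p+j} commutes with e₀ and anticommutes with e₁, …, e_p; conjugation records both signs
at once. -/
theorem unit_inl_mul_unit_inr (i : Fin (p + 1)) (j : Fin q) :
    unit p q (.inl i) * unit p q (.inr j) = unit p q (.inr j) * star (unit p q (.inl i)) := by
  refine Fin.cases ?_ (fun i => ?_) i
  · simp [unit_inl_zero]
  · rw [unit_inl_succ, unit_inr, star_gen, mul_neg, gen_mul_gen_comm_of_ne]
    intro h
    have := congrArg Fin.val h
    simp at this
    omega

theorem unit_inl_mul_vec (i : Fin (p + 1)) (y : EuclideanSpace ℝ (Fin q)) :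
    unit p q (.inl i) * vec p y = vec p y * star (unit p q (.inl i)) := by
  simp only [vec, Finset.mul_sum, Finset.sum_mul, mul_smul_comm, smul_mul_assoc,
    unit_inl_mul_unit_inr]

theorem sum_unit_mul_unit (u : RealClifford (p + q)) :
    ∑ j : Fin q, unit p q (.inr j) * (unit p q (.inr j) * u) = -(q : ℝ) • u := by
  have h : ∀ j : Fin q, unit p q (.inr j) * (unit p q (.inr j) * u) = -u := fun j => by
    have h1 := gen_mul_gen_add_swap (Fin.natAdd p j) (Fin.natAdd p j)
    have h2 : (2 : ℝ) • (unit p q (.inr j) * (unit p q (.inr j) * u)) = (2 : ℝ) • -u := by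
      rw [← mul_assoc, ← smul_mul_assoc, two_smul, unit_inr, h1, if_pos rfl, neg_mul, two_eq_smul,
        smul_neg]
    exact smul_right_injective _ two_ne_zero h2
  simp [h, Finset.sum_const, ← Nat.cast_smul_eq_nsmul ℝ]

/-- The coefficients yᵢ yⱼ are symmetric, so only the diagonal terms survive. -/
theorem vec_mul_vec_mul (y : EuclideanSpace ℝ (Fin q)) (u : RealClifford (p + q)) :
    vec p y * (vec p y * u) = -(‖y‖ ^ 2) • u := by
  have key := sum_sum_apply_of_symm (a := fun j : Fin q => mulLeftCLM (star (unit p q (.inr j))))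
    (b := fun j => mulLeftCLM (unit p q (.inr j))) (fun i j v => by
      simp only [mulLeftCLM_apply, ← mul_assoc, ← add_mul, star_unit_mul_unit_add_swap,
        Sum.inr.injEq]
      split_ifs
      · exact two_eq_smul v
      · exact zero_mul v)
    (M := fun i j => (y i * y j) • u) (fun i j => by rw [mul_comm])
  have h : vec p y * (vec p y * u) = -∑ i, ∑ j, mulLeftCLM (star (unit p q (.inr i)))
      (mulLeftCLM (unit p q (.inr j)) ((y i * y j) • u)) := by
    simp only [vec, Finset.mul_sum, Finset.sum_mul, mulLeftCLM_apply, unit_inr, star_gen, neg_mul,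
      mul_smul_comm, smul_mul_assoc, Finset.smul_sum, smul_smul]
    rw [Finset.sum_comm]
    simp only [mul_comm, smul_neg, Finset.sum_neg_distrib, neg_neg]
  rw [h, key, EuclideanSpace.norm_sq_eq, neg_smul, Finset.sum_smul]
  simp [sq]

theorem isUnit_vec {y : EuclideanSpace ℝ (Fin q)} (hy : y ≠ 0) : IsUnit (vec p y) := by
  have hn : ‖y‖ ^ 2 ≠ 0 := pow_ne_zero 2 (norm_ne_zero_iff.2 hy)
  have h : vec p y * vec p y = -(‖y‖ ^ 2) • 1 := by simpa using vec_mul_vec_mul y 1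
  refine ⟨⟨vec p y, -(‖y‖ ^ 2)⁻¹ • vec p y, ?_, ?_⟩, rfl⟩
  · rw [mul_smul_comm, h, smul_smul]
    simp [hn]
  · rw [smul_mul_assoc, h, smul_smul]
    simp [hn]

theorem vec_smul (r : ℝ) (y : EuclideanSpace ℝ (Fin q)) : vec p (r • y) = r • vec p y := by
  simp [vec, Finset.smul_sum, smul_smul]

theorem vec_neg (y : EuclideanSpace ℝ (Fin q)) : vec p (-y) = -vec p y := by
  simp [vec]

end Units

/-! ### The splitting of the variables and the set Ω_D -/

section Completion

/-- The splitting `x ↦ (x_p, x_q)` as a continuous linear map. -/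
def splitCLM (p q : ℕ) :
    Paravector p q →L[ℝ] EuclideanSpace ℝ (Fin (p + 1)) × EuclideanSpace ℝ (Fin q) :=
  LinearMap.toContinuousLinearMap
    { toFun := fun x => (pPart x, qPart x)
      map_add' := fun _ _ => rfl
      map_smul' := fun _ _ => rfl }

theorem pPart_join (xp : EuclideanSpace ℝ (Fin (p + 1))) (y : EuclideanSpace ℝ (Fin q)) :
    pPart (join xp y) = xp := rfl

theorem qPart_join (xp : EuclideanSpace ℝ (Fin (p + 1))) (y : EuclideanSpace ℝ (Fin q)) :
    qPart (join xp y) = y := rfl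

theorem join_pPart_qPart (x : Paravector p q) : join (pPart x) (qPart x) = x := by
  ext i
  rcases i with i | i <;> rfl

theorem pPart_single_inl (i : Fin (p + 1)) :
    pPart (EuclideanSpace.single (.inl i) 1 : Paravector p q) = EuclideanSpace.single i 1 := by
  ext k
  simp [pPart]

theorem qPart_single_inl (i : Fin (p + 1)) :
    qPart (EuclideanSpace.single (.inl i) 1 : Paravector p q) = 0 := by
  ext k
  simp [qPart]

theorem pPart_single_inr (j : Fin q) :
    pPart (EuclideanSpace.single (.inr j) 1 : Paravector p q) = 0 := by
  ext k
  simp [pPart]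

theorem qPart_single_inr (j : Fin q) :
    qPart (EuclideanSpace.single (.inr j) 1 : Paravector p q) = EuclideanSpace.single j 1 := by
  ext k
  simp [qPart]

theorem exists_smul_unit (hq : 0 < q) (y : EuclideanSpace ℝ (Fin q)) :
    ∃ w : EuclideanSpace ℝ (Fin q), ‖w‖ = 1 ∧ y = ‖y‖ • w := by
  by_cases hy : y = 0
  · exact ⟨EuclideanSpace.single ⟨0, hq⟩ 1, by simp, by simp [hy]⟩
  · have hn : ‖y‖ ≠ 0 := norm_ne_zero_iff.2 hy
    exact ⟨‖y‖⁻¹ • y, by rw [norm_smul]; simp [hn], by rw [smul_smul]; simp [hn]⟩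

theorem mem_completion_iff (hq : 0 < q) {D : Set (Base p)} {x : Paravector p q} :
    x ∈ completion q D ↔ (pPart x, ‖qPart x‖) ∈ D := by
  constructor
  · rintro ⟨xp, r, w, hr, hw, hD, rfl⟩
    rwa [pPart_join, qPart_join, norm_smul, hw, mul_one, Real.norm_of_nonneg hr]
  · intro h
    obtain ⟨w, hw, hy⟩ := exists_smul_unit hq (qPart x)
    exact ⟨pPart x, ‖qPart x‖, w, norm_nonneg _, hw, h, by rw [← hy, join_pPart_qPart]⟩

theorem continuous_pPart_norm_qPart :
    Continuous fun x : Paravector p q => ((pPart x, ‖qPart x‖) : Base p) := by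
  have h := (splitCLM p q).continuous
  exact (continuous_fst.comp h).prodMk (continuous_norm.comp (continuous_snd.comp h))

theorem isOpen_completion (hq : 0 < q) {D : Set (Base p)} (hD : IsOpen D) :
    IsOpen (completion q D) := by
  convert hD.preimage (continuous_pPart_norm_qPart (p := p) (q := q)) using 1
  ext x
  exact mem_completion_iff hq

/-- A continuous function on an open set that vanishes off the subspace `x_q = 0` vanishes. -/
theorem eq_zero_of_eq_zero_off_axis (hq : 0 < q) {U : Set (Paravector p q)} (hU : IsOpen U)
    {φ : Paravector p q → RealClifford (p + q)} (hφ : ContinuousOn φ U)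
    (h : ∀ x ∈ U, qPart x ≠ 0 → φ x = 0) : ∀ x ∈ U, φ x = 0 := by
  intro x hx
  by_cases hy : qPart x = 0
  -- A point of the axis is approached along e_{p+1}, which exists because q > 0.
  · set e : Paravector p q := EuclideanSpace.single (.inr ⟨0, hq⟩) 1
    have hl : Tendsto (fun t : ℝ => x + t • e) (𝓝[≠] 0) (𝓝 x) := by
      have hc : Continuous fun t : ℝ => x + t • e := by fun_prop
      have := hc.tendsto 0
      rw [zero_smul, add_zero] at this
      exact this.mono_left nhdsWithin_le_nhds
    have h1 : Tendsto (fun t : ℝ => φ (x + t • e)) (𝓝[≠] 0) (𝓝 (φ x)) :=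
      (hφ.continuousAt (hU.mem_nhds hx)).tendsto.comp hl
    have h2 : (fun t : ℝ => φ (x + t • e)) =ᶠ[𝓝[≠] 0] fun _ => 0 := by
      filter_upwards [hl.eventually (hU.mem_nhds hx), self_mem_nhdsWithin] with t ht ht0
      refine h _ ht ?_
      have : qPart (x + t • e) = t • EuclideanSpace.single ⟨0, hq⟩ 1 := by
        rw [← qPart_single_inr (p := p), ← zero_add (t • qPart _), ← hy]
        rfl
      rw [this]
      exact smul_ne_zero ht0 (by simp)
    exact tendsto_nhds_unique (h1.congr' h2) tendsto_const_nhds |>.symm ▸ rfl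
  · exact h x hx hy

end Completion

end PartialSlice

/-! ### Functions of (x_p, |x_q|) off the axis and Bessel operators -/

namespace PartialSlice

variable {p q : ℕ}

open RealClifford

/-- The function `x ↦ w (x_p, |x_q|)`. -/
def radial {F : Type} (w : Base p → F) (x : Paravector p q) : F := w (pPart x, ‖qPart x‖)

/-- The `i`-th basis vector of `ℝ^(p+1)` in the space of the variables `(x_p, r)`. -/
abbrev baseVec (i : Fin (p + 1)) : Base p := (EuclideanSpace.single i 1, 0)

/-- The operator `r⁻¹ ∂_r`. -/
def invDerivR {F : Type} [NormedAddCommGroup F] [NormedSpace ℝ F] (w : Base p → F) (z : Base p) :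
    F :=
  z.2⁻¹ • dirDeriv (0, 1) w z

section OffAxis

variable {F : Type} [NormedAddCommGroup F] [NormedSpace ℝ F] {E : Set (Base p)}

theorem contDiffOn_invDerivR (hE : IsOpen E) (hE0 : ∀ z ∈ E, z.2 ≠ 0) {w : Base p → F}
    (hw : ContDiffOn ℝ ∞ w E) : ContDiffOn ℝ ∞ (invDerivR w) E :=
  (contDiffOn_snd.inv hE0).smul (contDiffOn_dirDeriv hE hw _)

theorem isOpen_radial_preimage (hE : IsOpen E) :
    IsOpen {x : Paravector p q | (pPart x, ‖qPart x‖) ∈ E} :=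
  hE.preimage continuous_pPart_norm_qPart

theorem qPart_ne_zero (hE0 : ∀ z ∈ E, z.2 ≠ 0) {x : Paravector p q}
    (hx : (pPart x, ‖qPart x‖) ∈ E) : qPart x ≠ 0 :=
  norm_ne_zero_iff.1 (hE0 _ hx)

theorem differentiableAt_radial {w : Base p → F} {x : Paravector p q}
    (hw : DifferentiableAt ℝ w (pPart x, ‖qPart x‖)) (hx : qPart x ≠ 0) :
    DifferentiableAt ℝ (radial w) x :=
  (HasFDerivAt.comp (g := fun z : EuclideanSpace ℝ (Fin (p + 1)) × EuclideanSpace ℝ (Fin q) =>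
    w (z.1, ‖z.2‖)) x (hasFDerivAt_comp_norm_of_ne hw hx)
    (splitCLM p q).hasFDerivAt).differentiableAt

theorem dirDeriv_radial {w : Base p → F} {x : Paravector p q}
    (hw : DifferentiableAt ℝ w (pPart x, ‖qPart x‖)) (hx : qPart x ≠ 0) (v : Paravector p q) :
    dirDeriv v (radial w) x =
      fderiv ℝ w (pPart x, ‖qPart x‖) (pPart v, ‖qPart x‖⁻¹ * inner ℝ (qPart x) (qPart v)) :=
  congrArg (· v) (HasFDerivAt.comp
    (g := fun z : EuclideanSpace ℝ (Fin (p + 1)) × EuclideanSpace ℝ (Fin q) => w (z.1, ‖z.2‖)) x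
    (hasFDerivAt_comp_norm_of_ne hw hx) (splitCLM p q).hasFDerivAt).fderiv

theorem dirDeriv_inl_radial {w : Base p → F} {x : Paravector p q}
    (hw : DifferentiableAt ℝ w (pPart x, ‖qPart x‖)) (hx : qPart x ≠ 0) (i : Fin (p + 1)) :
    dirDeriv (EuclideanSpace.single (.inl i) 1) (radial w) x =
      radial (dirDeriv (baseVec i) w) x := by
  rw [dirDeriv_radial hw hx, pPart_single_inl, qPart_single_inl, inner_zero_right, mul_zero]
  rfl

theorem dirDeriv_inr_radial {w : Base p → F} {x : Paravector p q}
    (hw : DifferentiableAt ℝ w (pPart x, ‖qPart x‖)) (hx : qPart x ≠ 0) (j : Fin q) :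
    dirDeriv (EuclideanSpace.single (.inr j) 1) (radial w) x =
      x (.inr j) • radial (invDerivR w) x := by
  rw [dirDeriv_radial hw hx, pPart_single_inr, qPart_single_inr]
  have h : ((0 : EuclideanSpace ℝ (Fin (p + 1))), ‖qPart x‖⁻¹ * inner ℝ (qPart x)
      (EuclideanSpace.single j 1)) = (x (.inr j) * ‖qPart x‖⁻¹) •
        ((0, 1) : EuclideanSpace ℝ (Fin (p + 1)) × ℝ) := by
    refine Prod.ext (by simp) ?_
    simp [EuclideanSpace.inner_single_right, qPart, mul_comm]
  rw [h, map_smul, mul_smul]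
  rfl

theorem dirDeriv_coord (x : Paravector p q) (α : Fin (p + 1) ⊕ Fin q) (v : Paravector p q) :
    dirDeriv v (fun x : Paravector p q => x α) x = v α :=
  congrArg (· v) (EuclideanSpace.proj (𝕜 := ℝ) α : Paravector p q →L[ℝ] ℝ).hasFDerivAt.fderiv

theorem differentiableAt_coord (x : Paravector p q) (α : Fin (p + 1) ⊕ Fin q) :
    DifferentiableAt ℝ (fun x : Paravector p q => x α) x :=
  (EuclideanSpace.proj (𝕜 := ℝ) α : Paravector p q →L[ℝ] ℝ).differentiableAt

theorem sum_sq_inr (x : Paravector p q) : ∑ j : Fin q, x (.inr j) * x (.inr j) = ‖qPart x‖ ^ 2 := by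
  rw [EuclideanSpace.norm_sq_eq]
  simp [qPart, sq]

/-- The operator `Δ_{x_p} + ∂_r² + (k / r) ∂_r`, written with `r⁻¹ ∂_r` in place of `∂_r`. -/
def besselOp (k : ℝ) (w : Base p → F) (z : Base p) : F :=
  ∑ i, dirDeriv (baseVec i) (dirDeriv (baseVec i) w) z + (k + 1) • invDerivR w z +
    z.2 ^ 2 • invDerivR (invDerivR w) z

theorem contDiffOn_radial (hE0 : ∀ z ∈ E, z.2 ≠ 0) {w : Base p → F}
    (hw : ContDiffOn ℝ ∞ w E) :
    ContDiffOn ℝ ∞ (radial w) {x : Paravector p q | (pPart x, ‖qPart x‖) ∈ E} := by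
  have hs := (splitCLM p q).contDiff (n := ∞)
  refine hw.comp (ContDiffOn.prodMk (contDiff_fst.comp hs).contDiffOn ?_) fun x hx => hx
  exact (contDiff_snd.comp hs).contDiffOn.norm ℝ fun x hx => qPart_ne_zero hE0 hx

/-- With S = r⁻¹ ∂_r one has ∂_{xⱼ} = xⱼ S on radial functions, so the second derivatives in x_q sum
to q S + r² S². Since ∂_r² = S + r² S², this is ∂_r² + ((q - 1)/r) ∂_r; the same identity explains
the k + 1 in `besselOp`. -/
theorem laplacian_radial (hE : IsOpen E) (hE0 : ∀ z ∈ E, z.2 ≠ 0) {w : Base p → F}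
    (hw : ContDiffOn ℝ ∞ w E) :
    EqOn (laplacian (radial w)) (radial (besselOp ((q : ℝ) - 1) w))
      {x : Paravector p q | (pPart x, ‖qPart x‖) ∈ E} := by
  intro x hx
  have hU := isOpen_radial_preimage (q := q) hE
  have hdiff : ∀ {w : Base p → F}, ContDiffOn ℝ ∞ w E → ∀ {x : Paravector p q},
      (pPart x, ‖qPart x‖) ∈ E → DifferentiableAt ℝ w (pPart x, ‖qPart x‖) :=
    fun hw _ hx => hw.differentiableAt_of_isOpen hE hx
  have hS := contDiffOn_invDerivR hE hE0 hw
  rw [laplacian_eq_sum_dirDeriv hU (contDiffOn_radial hE0 hw) hx, Fintype.sum_sum_type]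
  have h1 : ∀ i : Fin (p + 1), dirDeriv (EuclideanSpace.single (.inl i) 1)
      (dirDeriv (EuclideanSpace.single (.inl i) 1) (radial w)) x =
      radial (dirDeriv (baseVec i) (dirDeriv (baseVec i) w)) x := fun i => by
    rw [dirDeriv_congr hU (fun y hy => dirDeriv_inl_radial (hdiff hw hy) (qPart_ne_zero hE0 hy) i) _
      hx, dirDeriv_inl_radial (hdiff (contDiffOn_dirDeriv hE hw _) hx) (qPart_ne_zero hE0 hx)]
  have h2 : ∀ j : Fin q, dirDeriv (EuclideanSpace.single (.inr j) 1)
      (dirDeriv (EuclideanSpace.single (.inr j) 1) (radial w)) x =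
      radial (invDerivR w) x + (x (.inr j) * x (.inr j)) • radial (invDerivR (invDerivR w)) x :=
    fun j => by
    rw [dirDeriv_congr hU (fun y hy => dirDeriv_inr_radial (hdiff hw hy) (qPart_ne_zero hE0 hy) j) _
      hx, dirDeriv_smul (differentiableAt_coord x _)
        (differentiableAt_radial (hdiff hS hx) (qPart_ne_zero hE0 hx)), dirDeriv_coord,
      dirDeriv_inr_radial (hdiff hS hx) (qPart_ne_zero hE0 hx), mul_smul]
    simp
  simp_rw [h1, h2, Finset.sum_add_distrib, ← Finset.sum_smul, sum_sq_inr]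
  simp only [radial, besselOp, sub_add_cancel, Finset.sum_const, Finset.card_univ,
    Fintype.card_fin, ← Nat.cast_smul_eq_nsmul ℝ, add_assoc]

theorem hasFDerivAt_snd_base (z : Base p) :
    HasFDerivAt (fun z : Base p => z.2) (ContinuousLinearMap.snd ℝ _ ℝ) z := hasFDerivAt_snd

theorem dirDeriv_snd (z v : Base p) : dirDeriv v (fun z : Base p => z.2) z = v.2 :=
  congrArg (· v) (hasFDerivAt_snd_base z).fderiv

theorem smul_invDerivR {w : Base p → F} {z : Base p} (hz : z.2 ≠ 0) :
    z.2 • invDerivR w z = dirDeriv (0, 1) w z := by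
  simp [invDerivR, hz]

theorem invDerivR_dirDeriv (hE : IsOpen E) (hE0 : ∀ z ∈ E, z.2 ≠ 0) {w : Base p → F}
    (hw : ContDiffOn ℝ ∞ w E) (i : Fin (p + 1)) :
    EqOn (invDerivR (dirDeriv (baseVec i) w)) (dirDeriv (baseVec i) (invDerivR w)) E := by
  intro z hz
  have h1 : DifferentiableAt ℝ (fun z : Base p => z.2⁻¹) z :=
    differentiableAt_snd.inv (hE0 z hz)
  have h2 : dirDeriv (baseVec i) (fun z : Base p => z.2⁻¹) z = 0 := by
    refine (congrArg (· (baseVec i)) ((hasDerivAt_inv (hE0 z hz)).hasFDerivAt.comp z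
      (hasFDerivAt_snd_base z)).fderiv).trans ?_
    simp
  rw [show invDerivR w = fun z => z.2⁻¹ • dirDeriv (0, 1) w z from rfl,
    dirDeriv_smul h1 ((contDiffOn_dirDeriv hE hw _).differentiableAt_of_isOpen hE hz), h2,
    zero_smul, zero_add, dirDeriv_comm hE hw _ _ hz]
  rfl

theorem dirDeriv_last_sq (z : Base p) :
    dirDeriv (0, 1) (fun z : Base p => z.2 ^ 2) z = 2 * z.2 := by
  unfold dirDeriv
  rw [((hasFDerivAt_snd_base z).pow 2).fderiv]
  simp

/-- The operator `r⁻¹ ∂_r` maps solutions of `besselOp k` to solutions of `besselOp (k + 2)`. -/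
theorem besselOp_invDerivR (hE : IsOpen E) (hE0 : ∀ z ∈ E, z.2 ≠ 0) {w : Base p → F}
    (hw : ContDiffOn ℝ ∞ w E) {k : ℝ} (h : ∀ z ∈ E, besselOp k w z = 0) :
    ∀ z ∈ E, besselOp (k + 2) (invDerivR w) z = 0 := by
  intro z hz
  have hS := contDiffOn_invDerivR hE hE0 hw
  have hSS := contDiffOn_invDerivR hE hE0 hS
  have hd := fun i => contDiffOn_dirDeriv hE hw (baseVec i)
  have hdd := fun i => contDiffOn_dirDeriv hE (hd i) (baseVec i)
  have hda : ∀ {u : Base p → F}, ContDiffOn ℝ ∞ u E → DifferentiableAt ℝ u z := fun hu =>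
    hu.differentiableAt_of_isOpen hE hz
  -- Applying S to the equation, the coefficient r² contributes 2 S² w, which is the shift of k by
  -- 2.
  have h0 : dirDeriv (0, 1) (besselOp k w) z = 0 := by
    rw [dirDeriv_congr hE (g := fun _ => 0) (fun z hz => h z hz) _ hz]
    simp [dirDeriv]
  have hsq : DifferentiableAt ℝ (fun z : Base p => z.2 ^ 2) z := by fun_prop
  have hsum : DifferentiableAt ℝ
      (fun z => ∑ i, dirDeriv (baseVec i) (dirDeriv (baseVec i) w) z) z :=
    hda (ContDiffOn.sum fun i _ => hdd i)
  have hks : DifferentiableAt ℝ (fun z => (k + 1) • invDerivR w z) z := (hda hS).const_smul _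
  have hss : DifferentiableAt ℝ (fun z => z.2 ^ 2 • invDerivR (invDerivR w) z) z :=
    hsq.smul (hda hSS)
  unfold besselOp at h0
  rw [dirDeriv_add (hsum.fun_add hks) hss, dirDeriv_add hsum hks, dirDeriv_sum fun i => hda (hdd i),
    dirDeriv_const_smul _ (hda hS), dirDeriv_smul hsq (hda hSS), dirDeriv_last_sq] at h0
  have h1 : ∀ i, dirDeriv (baseVec i) (dirDeriv (baseVec i) (invDerivR w)) z =
      z.2⁻¹ • dirDeriv (0, 1) (dirDeriv (baseVec i) (dirDeriv (baseVec i) w)) z := fun i => by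
    rw [← dirDeriv_congr hE (invDerivR_dirDeriv hE hE0 hw i) _ hz,
      ← invDerivR_dirDeriv hE hE0 (hd i) i hz]
    rfl
  have h2 := congrArg (z.2⁻¹ • ·) h0
  simp only [smul_zero] at h2
  rw [← h2]
  have hz0 := hE0 z hz
  simp only [besselOp, h1, ← Finset.smul_sum, smul_add]
  simp only [← smul_invDerivR hz0]
  generalize invDerivR (invDerivR (invDerivR w)) z = c, invDerivR (invDerivR w) z = b
  match_scalars <;> field_simp
  ring

/-- Powers of the Laplacian annihilate radial extensions of solutions of
`besselOp (q - 1 - 2 n)`. -/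
theorem iterate_laplacian_radial_eq_zero (hE : IsOpen E) (hE0 : ∀ z ∈ E, z.2 ≠ 0) (n : ℕ) :
    ∀ {w : Base p → F}, ContDiffOn ℝ ∞ w E →
      (∀ z ∈ E, besselOp ((q : ℝ) - 1 - 2 * n) w z = 0) →
      ∀ x : Paravector p q, (pPart x, ‖qPart x‖) ∈ E → (laplacian^[n + 1] (radial w)) x = 0 := by
  have hU := isOpen_radial_preimage (q := q) hE
  induction n with
  | zero =>
    intro w hw h x hx
    refine (laplacian_radial hE hE0 hw hx).trans ?_
    simpa [radial] using h _ hx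
  | succ n ih =>
    intro w hw h x hx
    have hS := contDiffOn_invDerivR hE hE0 hw
    -- Subtracting the equation satisfied by w from `besselOp (q - 1)` leaves only the difference of
    -- the parameters, 2 (n + 1), times r⁻¹ ∂_r w.
    have h1 : EqOn (laplacian (radial w))
        (fun x => (2 * ((n : ℝ) + 1)) • radial (invDerivR w) x)
        {x : Paravector p q | (pPart x, ‖qPart x‖) ∈ E} := fun y hy => by
      rw [laplacian_radial hE hE0 hw hy, ← sub_zero (radial _ y), ← h _ hy]
      simp only [radial, besselOp]
      push_cast
      module
    refine (iterate_laplacian_congr_of_isOpen hU (n + 1) h1 hx).trans ?_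
    refine (iterate_laplacian_const_smul hU _ _ (contDiffOn_radial hE0 hS) hx).trans ?_
    simp only
    rw [ih hS (fun z hz => ?_) x hx, smul_zero]
    have := besselOp_invDerivR hE hE0 hw h z hz
    convert this using 2
    push_cast
    ring

end OffAxis

end PartialSlice

/-! ### The Cauchy-Riemann system: harmonicity, the operator D_x, the spherical derivative -/

namespace PartialSlice

variable {p q : ℕ}

open RealClifford

/-- The second component of a smooth solution of a generalized Cauchy-Riemann system is
harmonic. -/
theorem harmonic_of_cauchyRiemann {F : Type} [NormedAddCommGroup F] [NormedSpace ℝ F]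
    {D : Set (Base p)} (hD : IsOpen D) {a b : Fin (p + 1) → F →L[ℝ] F}
    (hba : ∀ i j u, b i (a j u) + b j (a i u) = if i = j then (2 : ℝ) • u else 0)
    {F₁ F₂ : Base p → F} (hF₁ : ContDiffOn ℝ ∞ F₁ D) (hF₂ : ContDiffOn ℝ ∞ F₂ D)
    (h1 : ∀ z ∈ D, ∑ i, b i (dirDeriv (baseVec i) F₁ z) = dirDeriv (0, 1) F₂ z)
    (h2 : ∀ z ∈ D, ∑ i, a i (dirDeriv (baseVec i) F₂ z) = -dirDeriv (0, 1) F₁ z) {z : Base p}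
    (hz : z ∈ D) :
    ∑ i, dirDeriv (baseVec i) (dirDeriv (baseVec i) F₂) z +
      dirDeriv (0, 1) (dirDeriv (0, 1) F₂) z = 0 := by
  have hd₁ := fun v => contDiffOn_dirDeriv hD hF₁ v
  have hd₂ := fun v => contDiffOn_dirDeriv hD hF₂ v
  -- ∂_r² F₂ becomes ∑ bᵢ ∂_r ∂ᵢ F₁, while ∑ ∂ᵢ² F₂ = ∑ bᵢ ∂ᵢ (∑ aⱼ ∂ⱼ F₂) becomes its negative; the
  -- terms cancel for each i.
  rw [← dirDeriv_congr hD h1 _ hz, dirDeriv_sum fun i =>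
      (contDiffOn_clm (b i) (hd₁ _)).differentiableAt_of_isOpen hD hz,
    ← sum_sum_apply_of_symm hba fun i j => dirDeriv_comm hD hF₂ (baseVec i) (baseVec j) hz,
    ← Finset.sum_add_distrib]
  refine Finset.sum_eq_zero fun i _ => ?_
  rw [dirDeriv_clm (b i) ((hd₁ _).differentiableAt_of_isOpen hD hz), dirDeriv_comm hD hF₁ _ _ hz]
  have h3 : dirDeriv (0, 1) F₁ = fun z => - -dirDeriv (0, 1) F₁ z := by simp
  rw [h3, dirDeriv_neg, ← dirDeriv_congr hD h2 _ hz, dirDeriv_sum fun j =>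
      (contDiffOn_clm (a j) (hd₂ _)).differentiableAt_of_isOpen hD hz]
  simp_rw [dirDeriv_clm _ ((hd₂ _).differentiableAt_of_isOpen hD hz)]
  simp

section Quotient

variable {F : Type} [NormedAddCommGroup F] [NormedSpace ℝ F] {E : Set (Base p)}
  {w F₂ : Base p → F}

theorem dirDeriv_last_of_eq_smul (hE : IsOpen E) (hE0 : ∀ z ∈ E, z.2 ≠ 0)
    (hw : ContDiffOn ℝ ∞ w E) (hF : EqOn F₂ (fun z => z.2 • w z) E) :
    EqOn (dirDeriv (0, 1) F₂) (fun z => w z + z.2 ^ 2 • invDerivR w z) E := fun z hz => by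
  rw [dirDeriv_congr hE hF _ hz, dirDeriv_smul (hasFDerivAt_snd_base z).differentiableAt
    (hw.differentiableAt_of_isOpen hE hz), dirDeriv_snd, ← smul_invDerivR (hE0 z hz)]
  simp only
  module

theorem dirDeriv_baseVec_of_eq_smul (hE : IsOpen E) (hw : ContDiffOn ℝ ∞ w E)
    (hF : EqOn F₂ (fun z => z.2 • w z) E) (i : Fin (p + 1)) :
    EqOn (dirDeriv (baseVec i) F₂) (fun z => z.2 • dirDeriv (baseVec i) w z) E := fun z hz => by
  rw [dirDeriv_congr hE hF _ hz, dirDeriv_smul (hasFDerivAt_snd_base z).differentiableAt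
    (hw.differentiableAt_of_isOpen hE hz), dirDeriv_snd]
  simp

/-- By Leibniz, ∂_r²(r w) = r (∂_r² w + (2/r) ∂_r w); this is where the starting parameter 2 comes
from. -/
theorem besselOp_two_eq_zero_of_harmonic (hE : IsOpen E) (hE0 : ∀ z ∈ E, z.2 ≠ 0)
    (hw : ContDiffOn ℝ ∞ w E) (hF : EqOn F₂ (fun z => z.2 • w z) E)
    (hΔ : ∀ z ∈ E, ∑ i, dirDeriv (baseVec i) (dirDeriv (baseVec i) F₂) z +
      dirDeriv (0, 1) (dirDeriv (0, 1) F₂) z = 0) : ∀ z ∈ E, besselOp 2 w z = 0 := by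
  intro z hz
  have hz0 := hE0 z hz
  have hS := contDiffOn_invDerivR hE hE0 hw
  have hSz := hS.differentiableAt_of_isOpen hE hz
  have hsq : DifferentiableAt ℝ (fun z : Base p => z.2 ^ 2) z := by fun_prop
  have h1 : ∀ i, dirDeriv (baseVec i) (dirDeriv (baseVec i) F₂) z =
      z.2 • dirDeriv (baseVec i) (dirDeriv (baseVec i) w) z := fun i =>
    dirDeriv_baseVec_of_eq_smul hE (contDiffOn_dirDeriv hE hw _)
      (dirDeriv_baseVec_of_eq_smul hE hw hF i) i hz
  have h2 := hΔ z hz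
  rw [dirDeriv_congr hE (dirDeriv_last_of_eq_smul hE hE0 hw hF) _ hz,
    dirDeriv_add (hw.differentiableAt_of_isOpen hE hz) (hsq.fun_smul hSz),
    dirDeriv_smul hsq hSz, dirDeriv_last_sq, ← smul_invDerivR hz0, ← smul_invDerivR hz0] at h2
  simp_rw [h1, ← Finset.smul_sum] at h2
  have h3 : z.2 • besselOp 2 w z = 0 := by
    rw [← h2, besselOp]
    module
  exact (smul_eq_zero.1 h3).resolve_left hz0

end Quotient

theorem diracOp_eq_sum (f : Paravector p q → RealClifford (p + q)) (x : Paravector p q) :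
    diracOp f x = ∑ α, mulLeftCLM (unit p q α) (dirDeriv (EuclideanSpace.single α 1) f x) := rfl

theorem vec_mul_eq_sum (g : Paravector p q → RealClifford (p + q)) :
    (fun x => vec p (qPart x) * g x) = fun x =>
      ∑ j : Fin q, x (.inr j) • mulLeftCLM (unit p q (.inr j)) (g x) := by
  funext x
  simp [vec, qPart, Finset.sum_mul]

theorem dirDeriv_vec_mul_radial {w : Base p → RealClifford (p + q)} {x : Paravector p q}
    (hw : DifferentiableAt ℝ (radial w) x) (v : Paravector p q) :
    dirDeriv v (fun x => vec p (qPart x) * radial w x) x =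
      vec p (qPart v) * radial w x + vec p (qPart x) * dirDeriv v (radial w) x := by
  have h := vec_mul_eq_sum (radial w)
  have hd : ∀ j : Fin q, DifferentiableAt ℝ
      (fun x => mulLeftCLM (unit p q (.inr j)) (radial w x)) x := fun j =>
    (mulLeftCLM (unit p q (.inr j))).differentiableAt.comp x hw
  rw [h, dirDeriv_sum fun j => (differentiableAt_coord x _).fun_smul (hd j)]
  simp_rw [dirDeriv_smul (differentiableAt_coord x _) (hd _), dirDeriv_coord, dirDeriv_clm _ hw]
  simp [vec, qPart, Finset.sum_mul, Finset.sum_add_distrib]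

theorem vec_single (j : Fin q) : vec p (EuclideanSpace.single j 1) = unit p q (.inr j) := by
  simp [vec]

/-- The operator `D_x` maps a generalized partial-slice regular function to `1 - q` times its
spherical derivative. -/
theorem diracOp_radial_add_vec_mul_radial {E : Set (Base p)} (hE : IsOpen E)
    (hE0 : ∀ z ∈ E, z.2 ≠ 0) {F₁ w : Base p → RealClifford (p + q)} (hF₁ : ContDiffOn ℝ ∞ F₁ E)
    (hw : ContDiffOn ℝ ∞ w E)
    (h1 : ∀ z ∈ E, ∑ i, unit p q (.inl i) * dirDeriv (baseVec i) F₁ z =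
      w z + z.2 ^ 2 • invDerivR w z)
    (h2 : ∀ z ∈ E, ∑ i, star (unit p q (.inl i)) * dirDeriv (baseVec i) w z = -invDerivR F₁ z)
    {x : Paravector p q} (hx : (pPart x, ‖qPart x‖) ∈ E) :
    diracOp (fun x => radial F₁ x + vec p (qPart x) * radial w x) x =
      (1 - (q : ℝ)) • radial w x := by
  have hx0 := qPart_ne_zero hE0 hx
  have hF₁z := hF₁.differentiableAt_of_isOpen hE hx
  have hwz := hw.differentiableAt_of_isOpen hE hx
  have hvd : DifferentiableAt ℝ (fun x : Paravector p q => vec p (qPart x) * radial w x) x := by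
    have h := vec_mul_eq_sum (radial w)
    rw [h]
    exact DifferentiableAt.fun_sum fun j _ => (differentiableAt_coord x _).smul
      ((mulLeftCLM (unit p q (.inr j))).differentiableAt.comp x (differentiableAt_radial hwz hx0))
  rw [diracOp_eq_sum, Fintype.sum_sum_type]
  simp_rw [dirDeriv_add (differentiableAt_radial hF₁z hx0) hvd,
    dirDeriv_vec_mul_radial (differentiableAt_radial hwz hx0), dirDeriv_inl_radial hF₁z hx0,
    dirDeriv_inl_radial hwz hx0, dirDeriv_inr_radial hF₁z hx0, dirDeriv_inr_radial hwz hx0,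
    qPart_single_inl, qPart_single_inr, vec_single, mulLeftCLM_apply, mul_add]
  have e0 : vec p (0 : EuclideanSpace ℝ (Fin q)) = 0 := by simp [vec]
  -- With S = r⁻¹ ∂_r, the four contributions are w + r² S w from `e1`, -x_q S F₁ from `e2`, x_q S
  -- F₁ from `e3`, and -q w - r² S w from the squares eⱼ² = -1 and `e4`.
  have e1 : ∑ i, unit p q (.inl i) * radial (dirDeriv (baseVec i) F₁) x =
      radial w x + ‖qPart x‖ ^ 2 • radial (invDerivR w) x := h1 _ hx
  have e2 : ∑ i, unit p q (.inl i) * (vec p (qPart x) * radial (dirDeriv (baseVec i) w) x) =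
      -(vec p (qPart x) * radial (invDerivR F₁) x) := by
    simp_rw [← mul_assoc, unit_inl_mul_vec]
    simp_rw [mul_assoc, ← Finset.mul_sum]
    rw [← mul_neg]
    exact congrArg _ (h2 _ hx)
  have e3 : ∀ u : RealClifford (p + q), ∑ j : Fin q, unit p q (.inr j) * (x (.inr j) • u) =
      vec p (qPart x) * u := fun u => by
    simp [vec, qPart, Finset.sum_mul]
  have e4 : ∑ j : Fin q, unit p q (.inr j) *
      (vec p (qPart x) * (x (.inr j) • radial (invDerivR w) x)) =
      -(‖qPart x‖ ^ 2) • radial (invDerivR w) x := by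
    rw [← vec_mul_vec_mul, ← e3]
    simp only [mul_smul_comm]
  simp only [e0, zero_mul, mul_zero, zero_add, Finset.sum_add_distrib, e1, e2, e3, e4,
    sum_unit_mul_unit]
  module

theorem contDiffOn_radial_of_even {F : Type} [NormedAddCommGroup F] [NormedSpace ℝ F]
    [CompleteSpace F] (hq : 0 < q) {D : Set (Base p)} (hD : IsOpen D)
    (hsymm : ∀ xp r, (xp, r) ∈ D → (xp, -r) ∈ D) {w : Base p → F} (hw : ContDiffOn ℝ ∞ w D)
    (heven : ∀ xp r, (xp, r) ∈ D → w (xp, -r) = w (xp, r)) :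
    ContDiffOn ℝ ∞ (radial w) (completion q D) :=
  (contDiffOn_comp_norm_of_even hD hsymm hw heven).comp (splitCLM p q).contDiff.contDiffOn
    fun _ hx => (mem_completion_iff hq).1 hx

theorem contDiffOn_vec_mul {U : Set (Paravector p q)} {g : Paravector p q → RealClifford (p + q)}
    (hg : ContDiffOn ℝ ∞ g U) : ContDiffOn ℝ ∞ (fun x => vec p (qPart x) * g x) U := by
  have h := vec_mul_eq_sum g
  rw [h]
  exact ContDiffOn.sum fun j _ =>
    (EuclideanSpace.proj (𝕜 := ℝ) (.inr j) : Paravector p q →L[ℝ] ℝ).contDiff.contDiffOn.smul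
      (contDiffOn_clm _ hg)

/-- Write x_q = r ω and move the factor r of F₂ = r w onto ω. Oddness of F₂ makes F₂ = r w hold at r
= 0 as well, so the axis is included. -/
theorem IsInducedBy.eq_radial (hq : 0 < q) {D : Set (Base p)}
    {F₁ F₂ : Base p → RealClifford (p + q)} {f : Paravector p q → RealClifford (p + q)}
    (h : IsInducedBy D F₁ F₂ f) :
    EqOn f (fun x => radial F₁ x + vec p (qPart x) * radial (divLast F₂) x)
      (completion q D) := by
  intro x hx
  have hD := (mem_completion_iff hq).1 hx
  obtain ⟨w, hw, hy⟩ := exists_smul_unit hq (qPart x)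
  have h1 := h.eq _ _ hD (norm_nonneg _) w hw
  rw [← hy, join_pPart_qPart] at h1
  have h2 : ‖qPart x‖ • divLast F₂ (pPart x, ‖qPart x‖) = F₂ (pPart x, ‖qPart x‖) :=
    smul_divLast fun h0 => eq_zero_of_odd h.odd hD h0
  rw [h1, ← h2, mul_smul_comm, ← smul_mul_assoc, ← vec_smul, ← hy]
  rfl

/-- Reflection fixes both radial factors and changes the sign of x_q, so the difference of the two
values is 2 x_q w. -/
theorem IsInducedBy.sphericalDeriv_eq (hq : 0 < q) {D : Set (Base p)}
    {F₁ F₂ : Base p → RealClifford (p + q)} {f : Paravector p q → RealClifford (p + q)}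
    (h : IsInducedBy D F₁ F₂ f) {x : Paravector p q} (hx : x ∈ completion q D)
    (hx0 : qPart x ≠ 0) : radial (divLast F₂) x = sphericalDeriv f x := by
  have hr : reflect x ∈ completion q D := by
    rw [mem_completion_iff hq] at hx ⊢
    simpa [reflect, pPart_join, qPart_join] using hx
  have h1 := h.eq_radial hq hx
  have h2 := h.eq_radial hq hr
  have h3 : ∀ w : Base p → RealClifford (p + q), radial w (reflect x) = radial w x := fun w => by
    simp [radial, reflect, pPart_join, qPart_join]
  simp only [h3] at h2
  have h4 : vec p (qPart (reflect x)) = -vec p (qPart x) := by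
    rw [reflect, qPart_join, vec_neg]
  rw [sphericalDeriv, h1, h2, h4]
  have h5 : radial F₁ x + vec p (qPart x) * radial (divLast F₂) x -
      (radial F₁ x + -vec p (qPart x) * radial (divLast F₂) x) =
      vec p (qPart x) * ((2 : ℝ) • radial (divLast F₂) x) := by
    rw [neg_mul, mul_smul_comm]
    module
  rw [h5, ← mul_assoc, Ring.inverse_mul_cancel _ (isUnit_vec hx0), one_mul, smul_smul]
  norm_num

theorem mulLeftCLM_star_unit (α β : Fin (p + 1) ⊕ Fin q) (u : RealClifford (p + q)) :
    mulLeftCLM (star (unit p q α)) (mulLeftCLM (unit p q β) u) +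
      mulLeftCLM (star (unit p q β)) (mulLeftCLM (unit p q α) u) =
      if α = β then (2 : ℝ) • u else 0 := by
  simp only [mulLeftCLM_apply, ← mul_assoc, ← add_mul, star_unit_mul_unit_add_swap]
  split_ifs
  · exact two_eq_smul u
  · exact zero_mul u

theorem mulLeftCLM_unit_star (α β : Fin (p + 1) ⊕ Fin q) (u : RealClifford (p + q)) :
    mulLeftCLM (unit p q α) (mulLeftCLM (star (unit p q β)) u) +
      mulLeftCLM (unit p q β) (mulLeftCLM (star (unit p q α)) u) =
      if α = β then (2 : ℝ) • u else 0 := by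
  simp only [mulLeftCLM_apply, ← mul_assoc, ← add_mul, unit_mul_star_unit_add_swap]
  split_ifs
  · exact two_eq_smul u
  · exact zero_mul u

section Regular

variable {D : Set (Base p)} {F₁ F₂ : Base p → RealClifford (p + q)}

theorem contDiffOn_of_regular (hD : IsOpen D) (hF₁ : ContDiffOn ℝ 1 F₁ D)
    (hF₂ : ContDiffOn ℝ 1 F₂ D)
    (hCR : ∀ x' ∈ D, diracP F₁ x' - derivR F₂ x' = 0 ∧ diracPConj F₂ x' + derivR F₁ x' = 0) :
    ContDiffOn ℝ ∞ F₁ D ∧ ContDiffOn ℝ ∞ F₂ D := by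
  have h1 : ∀ y ∈ D, ∑ i, mulLeftCLM (unit p q (.inl i))
      (fderiv ℝ F₁ y (EuclideanSpace.single i 1, 0)) = fderiv ℝ F₂ y (0, 1) := fun y hy =>
    sub_eq_zero.1 (hCR y hy).1
  have h2 : ∀ y ∈ D, ∑ i, mulLeftCLM (star (unit p q (.inl i)))
      (fderiv ℝ F₂ y (EuclideanSpace.single i 1, 0)) = -fderiv ℝ F₁ y (0, 1) := fun y hy =>
    eq_neg_of_add_eq_zero_left (hCR y hy).2
  have hab := fun i j u => mulLeftCLM_star_unit (p := p) (q := q) (.inl i) (.inl j) u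
  have hba := fun i j u => mulLeftCLM_unit_star (p := p) (q := q) (.inl i) (.inl j) u
  simp only [Sum.inl.injEq] at hab hba
  -- The pair (F₂, -F₁) solves the system with the operators and their conjugates exchanged, so
  -- Weyl's lemma for first components also covers F₂.
  refine ⟨contDiffOn_of_cauchyRiemann hab hD hF₁ hF₂ h1 h2,
    contDiffOn_of_cauchyRiemann hba hD hF₂ hF₁.neg (fun y hy => ?_) (fun y hy => ?_)⟩
  · rw [fderiv_fun_neg]
    exact h2 y hy
  · rw [fderiv_fun_neg]
    simp only [_root_.neg_apply, map_neg, Finset.sum_neg_distrib]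
    rw [h1 y hy]

end Regular

end PartialSlice

/-! ### The main theorem -/

open PartialSlice RealClifford in
theorem theorem3p7 (p q : ℕ) (hq : Odd q) (D : Set (PartialSlice.Base p)) (hD : IsOpen D)
    (hsymm : ∀ xp r, (xp, r) ∈ D → (xp, -r) ∈ D)
    (f : PartialSlice.Paravector p q → RealClifford (p + q))
    (hf : PartialSlice.IsRegular D f) :
    -- all derivatives below exist on `Ω_D` in the classical sense
    ContDiffOn ℝ ∞ f (PartialSlice.completion q D) ∧
    -- (i), where `g` is the spherical derivative of `f`, extended continuously to `Ω_D`
    (∃ g : PartialSlice.Paravector p q → RealClifford (p + q),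
      ContDiffOn ℝ ∞ g (PartialSlice.completion q D) ∧
      (∀ x ∈ PartialSlice.completion q D, PartialSlice.qPart x ≠ 0 →
        g x = PartialSlice.sphericalDeriv f x) ∧
      ∀ x ∈ PartialSlice.completion q D,
        PartialSlice.diracOp (laplacian^[(q - 1) / 2] f) x =
            (1 - (q : ℝ)) • (laplacian^[(q - 1) / 2] g) x ∧
          (1 - (q : ℝ)) • (laplacian^[(q - 1) / 2] g) x = 0) ∧
    -- (ii)
    ∀ x ∈ PartialSlice.completion q D, (laplacian^[(q + 1) / 2] f) x = 0 := by
  obtain ⟨F₁, F₂, hind, hF₁, hF₂, hCR⟩ := hf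
  have hq0 : 0 < q := hq.pos
  obtain ⟨m, hm⟩ := hq
  obtain ⟨hs₁, hs₂⟩ := contDiffOn_of_regular hD hF₁ hF₂ hCR
  have hw : ContDiffOn ℝ ∞ (divLast F₂) D :=
    contDiffOn_divLast hD hs₂ fun z hz h0 => eq_zero_of_odd hind.odd hz h0
  have hΩ := isOpen_completion (q := q) hq0 hD
  have hg : ContDiffOn ℝ ∞ (radial (divLast F₂)) (completion q D) :=
    contDiffOn_radial_of_even hq0 hD hsymm hw fun xp r h => divLast_even_of_odd hind.odd h
  have hfs : ContDiffOn ℝ ∞ f (completion q D) :=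
    ((contDiffOn_radial_of_even hq0 hD hsymm hs₁ hind.even).add (contDiffOn_vec_mul hg)).congr
      (hind.eq_radial hq0)
  -- Dividing by r requires r ≠ 0, so the identities are proved over E and then extended to the axis
  -- by continuity.
  set E : Set (Base p) := D ∩ {z | z.2 ≠ 0}
  have hE : IsOpen E := hD.inter (isOpen_ne_fun continuous_snd continuous_const)
  have hE0 : ∀ z ∈ E, z.2 ≠ 0 := fun z hz => hz.2
  have hmem : ∀ x ∈ completion q D, qPart x ≠ 0 → (pPart x, ‖qPart x‖) ∈ E := fun x hx h0 =>
    ⟨(mem_completion_iff hq0).1 hx, norm_ne_zero_iff.2 h0⟩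
  have hwE := hw.mono (inter_subset_left : E ⊆ D)
  have heq : EqOn F₂ (fun z => z.2 • divLast F₂ z) E := fun z hz =>
    (smul_divLast fun h0 => absurd h0 hz.2).symm
  have hbessel : ∀ z ∈ E, besselOp 2 (divLast F₂) z = 0 :=
    besselOp_two_eq_zero_of_harmonic hE hE0 hwE heq fun z hz =>
      harmonic_of_cauchyRiemann (a := fun i => mulLeftCLM (star (unit p q (.inl i))))
        (b := fun i => mulLeftCLM (unit p q (.inl i))) hD
        (fun i j u => by simpa using mulLeftCLM_unit_star (p := p) (q := q) (.inl i) (.inl j) u)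
        hs₁ hs₂ (fun z hz => sub_eq_zero.1 (hCR z hz).1)
        (fun z hz => eq_neg_of_add_eq_zero_left (hCR z hz).2) hz.1
  have hDf_off_axis : ∀ x ∈ completion q D, qPart x ≠ 0 →
      diracOp f x - (1 - (q : ℝ)) • radial (divLast F₂) x = 0 := by
    intro x hx h0
    have h1 : diracOp f x =
        diracOp (fun x => radial F₁ x + vec p (qPart x) * radial (divLast F₂) x) x := by
      simp only [diracOp, ((hind.eq_radial hq0).eventuallyEq_of_mem (hΩ.mem_nhds hx)).fderiv_eq]
    rw [h1, sub_eq_zero]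
    refine diracOp_radial_add_vec_mul_radial hE hE0 (hs₁.mono inter_subset_left) hwE
      (fun z hz => ?_) (fun z hz => ?_) (hmem x hx h0)
    · exact (sub_eq_zero.1 (hCR z hz.1).1).trans (dirDeriv_last_of_eq_smul hE hE0 hwE heq hz)
    · have h2 := eq_neg_of_add_eq_zero_left (hCR z hz.1).2
      have h3 : ∀ i, dirDeriv (baseVec i) (divLast F₂) z =
          z.2⁻¹ • dirDeriv (baseVec i) F₂ z := fun i => by
        rw [dirDeriv_baseVec_of_eq_smul hE hwE heq i hz, inv_smul_smul₀ (hE0 z hz)]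
      simp_rw [h3, mul_smul_comm, ← Finset.smul_sum]
      exact (congrArg (z.2⁻¹ • ·) h2).trans (smul_neg _ _)
  have hdirac : ∀ {h : Paravector p q → RealClifford (p + q)},
      ContDiffOn ℝ ∞ h (completion q D) → ContDiffOn ℝ ∞ (diracOp h) (completion q D) :=
    fun hh => ContDiffOn.sum fun α _ =>
      contDiffOn_clm (mulLeftCLM (unit p q α)) (contDiffOn_dirDeriv hΩ hh _)
  have hDf : EqOn (diracOp f) (fun x => (1 - (q : ℝ)) • radial (divLast F₂) x)
      (completion q D) := fun x hx =>
    sub_eq_zero.1 (eq_zero_of_eq_zero_off_axis hq0 hΩ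
      ((hdirac hfs).sub (hg.const_smul (1 - (q : ℝ)))).continuousOn hDf_off_axis x hx)
  have hDm : ∀ x ∈ completion q D, diracOp (laplacian^[m] f) x =
      (1 - (q : ℝ)) • (laplacian^[m] (radial (divLast F₂))) x := fun x hx =>
    ((sum_dirDeriv_iterate_laplacian hΩ (c := fun α => mulLeftCLM (unit p q α)) m hfs hx).trans
      (iterate_laplacian_congr_of_isOpen hΩ m hDf hx)).trans
      (iterate_laplacian_const_smul hΩ _ m hg hx)
  have hgm : ∀ x ∈ completion q D,
      (1 - (q : ℝ)) • (laplacian^[m] (radial (divLast F₂))) x = 0 := by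
    -- For m = 0, q = 1 and the scalar 1 - q is zero; the spherical derivative itself need not
    -- vanish.
    rcases m with _ | n
    · intro x _
      simp [hm]
    · intro x hx
      rw [eq_zero_of_eq_zero_off_axis hq0 hΩ
        (contDiffOn_iterate_laplacian hΩ (n + 1) hg).continuousOn (fun y hy h0 => ?_) x hx,
        smul_zero]
      refine iterate_laplacian_radial_eq_zero hE hE0 n hwE (fun z hz => ?_) y (hmem y hy h0)
      -- Here q = 2 (n + 1) + 1, so q - 1 - 2 n = 2.
      convert hbessel z hz using 2
      rw [hm]
      push_cast
      ring
  rw [show (q - 1) / 2 = m by omega, show (q + 1) / 2 = m + 1 by omega]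
  refine ⟨hfs, ⟨radial (divLast F₂), hg, fun x hx h0 => hind.sphericalDeriv_eq hq0 hx h0,
    fun x hx => ⟨hDm x hx, hgm x hx⟩⟩, fun x hx => ?_⟩
  have hzero : EqOn (diracOp (laplacian^[m] f)) (fun _ => 0) (completion q D) := fun y hy =>
    (hDm y hy).trans (hgm y hy)
  -- The last Laplacian is factored as the conjugate of D_x after D_x, and the inner factor vanishes
  -- on all of Ω_D by (i).
  rw [Function.iterate_succ_apply', laplacian_eq_sum_sum_dirDeriv hΩ
    (a := fun α => mulLeftCLM (star (unit p q α))) (b := fun α => mulLeftCLM (unit p q α))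
    mulLeftCLM_star_unit (contDiffOn_iterate_laplacian hΩ m hfs) hx]
  refine Finset.sum_eq_zero fun α _ => ?_
  have h1 : dirDeriv (EuclideanSpace.single α 1) (diracOp (laplacian^[m] f)) x = 0 :=
    (dirDeriv_congr hΩ hzero _ hx).trans (by simp [dirDeriv])
  exact (congrArg _ h1).trans (map_zero _)

end
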